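/- Let $d\ge 1$ be an integer, $s>0$, and let $f_s$ be the Bessel kernel on $\mathbb{R}^d$, i.e. the positive integrable function $$f_s(x)=\frac{1}{(4\pi)^{d/2}\Gamma(s/2)}\int_0^\infty e^{-u-|x|^2/(4u)}\,u^{(s-d)/2}\,\frac{du}{u},$$ whose Fourier transform is $\widehat f_s(\xi)=\int_{\mathbb{R}^d}e^{-ix\cdot\xi}f_s(x)\,dx=(1+|\xi|^2)^{-s/2}$. Set, with values in $[0,\infty]$, $$\Upsilon_\alpha(0)=(2\pi)^{-d}\int_{\mathbb{R}^d}\frac{\widehat f_s(\xi)\,d\xi}{|\xi|^{2(1-\alpha)}},\qquad \Upsilon(0)=\Upsilon_0(0),\qquad \mathcal{H}_\alpha(t)=\int_0^t dr\, r^{-2\alpha}\int_{\mathbb{R}^d}\widehat f_s(\xi)\,e^{-r|\xi|^2}\,d\xi .$$ **(1)** For every $\alpha\in\mathbb{R}$ with $s>d-2(1-\alpha)>0$, $$\Upsilon_\alpha(0)=\frac{\Gamma\left(\frac d2-1+\alpha\right)\Gamma\left(\frac{s-d}2+1-\alpha\right)}{2^d\pi^{d/2}\,\Gamma(d/2)\,\Gamma(s/2)}<\infty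 ;$$ in particular, if $s>d-2>0$, then $$\Upsilon(0)=\frac{\Gamma\left(\frac{2+s-d}2\right)}{2^{d-1}\pi^{d/2}(d-2)\Gamma(s/2)} .$$ **(2)** For every $\alpha>0$, $$\mathcal{H}_\alpha(t)<\infty\ \text{ for all } t>0\quad\Longleftrightarrow\quad \alpha<\frac12-\frac{(d-s)_+}{4}\ \text{ and }\ s>d-2,$$ where $a_+=\max(a,0)$. **(3)** For every $\alpha\in(0,1/2)$, as $t\to0^+$: (a) if $d-2<s<d$ and $\alpha<\frac12-\frac14(d-s)$, then $$\mathcal{H}_\alpha(t)=\frac{\pi^{d/2}\Gamma\left(\frac{d-s}2\right)}{\left(\frac{s-d}2+1-2\alpha\right)\Gamma(d/2)}\,t^{\frac{s-d}2+1-2\alpha}+\frac{\pi^{d/2}\Gamma\left(\frac{s-d}2\right)}{(1-2\alpha)\Gamma(s/2)}\,t^{1-2\alpha}+O\left(t^{\frac{s-d}2+2(1-\alpha)}\right);$$ (b) if $s=d$, then $$\mathcal{H}_\alpha(t)=\frac{\pi^{d/2}}{(1-2\alpha)\Gamma(d/2)}\,t^{1-2\alpha}\log\frac1t+\frac{\pi^{d/2}\left(1-(1-2\alpha)[\psi(d/2)+2\gamma]\right)}{(1-2\alpha)^2\,\Gamma(d/2)}\,t^{1-2\alpha}+O\left(t^{2(1-\alpha)}\log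 t\right);$$ (c) if $d<s<d+2$, then $$\mathcal{H}_\alpha(t)=\frac{\pi^{d/2}\Gamma\left(\frac{s-d}2\right)}{(1-2\alpha)\Gamma(s/2)}\,t^{1-2\alpha}+O\left(t^{\frac{s-d}2+1-2\alpha}\right);$$ (d) if $s=d+2$, then $$\mathcal{H}_\alpha(t)=\frac{\pi^{d/2}}{(1-2\alpha)\Gamma\left(\frac d2+1\right)}\,t^{1-2\alpha}+O\left(t^{2(1-\alpha)}\log t\right);$$ (e) if $s>d+2$, then $$\mathcal{H}_\alpha(t)=\frac{\pi^{d/2}\Gamma\left(\frac{s-d}2\right)}{(1-2\alpha)\Gamma(s/2)}\,t^{1-2\alpha}+O\left(t^{2(1-\alpha)}\right).$$ Here $\Gamma$ is the Gamma function, $\psi(x)=\frac{d}{dx}\log\Gamma(x)$ is the digamma function and $\gamma$ is Euler's constant. -/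

import Mathlib

open MeasureTheory Set Filter Topology Asymptotics

noncomputable section

namespace BesselNoise

/-- The Bessel kernel `f_s` on `ℝ^d`, `s > 0`, in its standard heat-semigroup form
`f_s(x) = 1 / ((4π)^{d/2} Γ(s/2)) ∫_0^∞ exp(-u - |x|² / (4u)) u^{(s-d)/2} du / u`,
the integrable function on `ℝ^d` with `∫ exp(-i x·ξ) f_s(x) dx = (1 + |ξ|²)^{-s/2}`.
The integral converges for every `x ≠ 0`. (When `s ≤ d` the kernel is infinite at the single
point `x = 0`; the value stored there is immaterial.) -/
def besselKernel (d : ℕ) (s : ℝ) (x : EuclideanSpace ℝ (Fin d)) : ℝ :=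
  ((4 * Real.pi) ^ ((d : ℝ) / 2) * Real.Gamma (s / 2))⁻¹ *
    ∫ u in Ioi (0 : ℝ), Real.exp (-u - ‖x‖ ^ 2 / (4 * u)) * u ^ ((s - d) / 2 - 1)

/-- The Fourier transform with the convention `𝓕φ(ξ) = ∫ exp(-i x·ξ) φ(x) dx`. -/
def fourierTransform {d : ℕ} (f : EuclideanSpace ℝ (Fin d) → ℝ)
    (ξ : EuclideanSpace ℝ (Fin d)) : ℂ :=
  ∫ x, Complex.exp (-(Complex.I * ((inner ℝ x ξ : ℝ) : ℂ))) * ((f x : ℝ) : ℂ)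

/-- The spectral measure `f̂(dξ) = f̂(ξ) dξ` of an integrable correlation function `f`
whose Fourier transform is real and nonnegative. -/
def spectralMeasure {d : ℕ} (f : EuclideanSpace ℝ (Fin d) → ℝ) :
    Measure (EuclideanSpace ℝ (Fin d)) :=
  volume.withDensity fun ξ => ENNReal.ofReal (fourierTransform f ξ).re

/-- `Υ_α(β) = (2π)^{-d} ∫ f̂(dξ) / (β + |ξ|²)^{1-α}`, as an extended nonnegative number,
for a spectral measure `μ = f̂`. -/
def upsilon {d : ℕ} (μ : Measure (EuclideanSpace ℝ (Fin d))) (α β : ℝ) : ENNReal :=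
  ENNReal.ofReal (((2 * Real.pi) ^ d)⁻¹) *
    ∫⁻ ξ, (ENNReal.ofReal (β + ‖ξ‖ ^ 2) ^ (1 - α))⁻¹ ∂μ

/-- `𝓗_α(t) = ∫_0^t dr r^{-2α} ∫ f̂(dξ) exp(-r|ξ|²)`, as an extended nonnegative number,
for a spectral measure `μ = f̂`. -/
def calH {d : ℕ} (μ : Measure (EuclideanSpace ℝ (Fin d))) (α t : ℝ) : ENNReal :=
  ∫⁻ r in Ioc (0 : ℝ) t, ENNReal.ofReal (r ^ (-(2 * α))) *
    ∫⁻ ξ, ENNReal.ofReal (Real.exp (-(r * ‖ξ‖ ^ 2))) ∂μ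

/-- The digamma function `ψ(x) = d/dx log Γ(x)` for `x > 0`. -/
def digamma (x : ℝ) : ℝ := deriv (fun y => Real.log (Real.Gamma y)) x

end BesselNoise

end

open MeasureTheory Set Filter Topology Asymptotics

noncomputable section

namespace BesselNoise

/-! The Bessel kernel is a Gamma-weighted mixture of Gaussians, so Fubini gives its transform as (1
+ |ξ|²)^{-s/2} (`fourierTransform_besselKernel`). The spectral integrals are therefore radial, and
in the variable v = |ξ|² they become half-line integrals times π^{d/2}/Γ(d/2) (`lintegral_normSq`).
For Υ_α(0) the result is a Beta integral. For 𝓗_α(t) it is ∫₀ᵗ r^{-2α} K(r) dr with K(r) = ∫₀^∞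
v^{a-1} (1+v)^{-c} e^{-rv} dv, a = d/2, c = s/2 (`kummer`, `calH_besselKernel`).

Finiteness depends only on the size of K near 0. K is bounded below by constant multiples of 1 and
of r^{c-a}, which forces both conditions on α. It is bounded above by a multiple of r^{-(a-c')} for
any admissible c', and c' can be chosen to make the time integral converge.

For the expansions, the integrand of K at r = 0 is split into a piece that carries any divergence,
whose Laplace transform is known exactly, and an integrable remainder. Removing e^{-rv} from the
remainder costs at most the integral of a majorant of |f(v)| (1 - e^{-rv})
(`exists_hasIntegralOn_mul_exp`). If c < a the singular piece is v^{a-1-c}, and the remainder has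
the analytically continued Beta value. If c = a it is the Frullani integrand (1 - e^{-v})/v, and the
remainder integrates to -ψ(a) - 2γ (`hasIntegralOn_logKernel`). If c > a nothing diverges, and only
the order of the error changes at c = a + 1. These bounds hold on all of (0, 1], so they can be
integrated against r^{-2α}.

The exact integrals come from Tonelli: a difference is written as an integral over a parameter θ,
and the order is exchanged (`HasIntegralOn.swap`). -/

/-- `f` is integrable on `s` (for Lebesgue measure on `ℝ`) with integral `A`. -/
def HasIntegralOn (f : ℝ → ℝ) (s : Set ℝ) (A : ℝ) : Prop :=
  IntegrableOn f s ∧ ∫ x in s, f x = A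

/-! ### Calculus of convergent integrals with known value -/

namespace HasIntegralOn

variable {f g : ℝ → ℝ} {s : Set ℝ} {A B : ℝ}

theorem congr (h : HasIntegralOn f s A) (hs : MeasurableSet s) (hfg : ∀ x ∈ s, f x = g x) :
    HasIntegralOn g s A :=
  ⟨h.1.congr_fun hfg hs, by rw [← h.2]; exact (setIntegral_congr_fun hs hfg).symm⟩

theorem congr_val (h : HasIntegralOn f s A) (hAB : A = B) : HasIntegralOn f s B := hAB ▸ h

theorem add (hf : HasIntegralOn f s A) (hg : HasIntegralOn g s B) :
    HasIntegralOn (fun x => f x + g x) s (A + B) :=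
  ⟨hf.1.add hg.1, by rw [integral_add hf.1 hg.1, hf.2, hg.2]⟩

theorem sub (hf : HasIntegralOn f s A) (hg : HasIntegralOn g s B) :
    HasIntegralOn (fun x => f x - g x) s (A - B) :=
  ⟨hf.1.sub hg.1, by rw [integral_sub hf.1 hg.1, hf.2, hg.2]⟩

theorem const_mul (hf : HasIntegralOn f s A) (k : ℝ) :
    HasIntegralOn (fun x => k * f x) s (k * A) :=
  ⟨hf.1.const_mul k, by rw [integral_const_mul, hf.2]⟩

theorem mono_val (hf : HasIntegralOn f s A) (hg : HasIntegralOn g s B) (hs : MeasurableSet s)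
    (h : ∀ x ∈ s, f x ≤ g x) : A ≤ B := by
  rw [← hf.2, ← hg.2]
  exact setIntegral_mono_on hf.1 hg.1 hs h

theorem lintegral (hf : HasIntegralOn f s A) (hs : MeasurableSet s) (h0 : ∀ x ∈ s, 0 ≤ f x) :
    ∫⁻ x in s, ENNReal.ofReal (f x) = ENNReal.ofReal A := by
  rw [← hf.2, ofReal_integral_eq_lintegral_ofReal hf.1]
  exact (ae_restrict_iff' hs).2 (ae_of_all _ h0)

/-- Tonelli's theorem for a nonnegative kernel, in terms of `HasIntegralOn`. -/
theorem swap {F : ℝ → ℝ → ℝ} {t : Set ℝ} {h : ℝ → ℝ} (hA : HasIntegralOn g s A)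
    (hs : MeasurableSet s) (ht : MeasurableSet t)
    (hF : Measurable (Function.uncurry F)) (h0 : ∀ x ∈ s, ∀ y ∈ t, 0 ≤ F x y)
    (hg : ∀ x ∈ s, HasIntegralOn (F x) t (g x))
    (hh : ∀ y ∈ t, HasIntegralOn (fun x => F x y) s (h y)) :
    HasIntegralOn h t A := by
  have hint : Integrable (Function.uncurry F)
      ((volume.restrict s).prod (volume.restrict t)) := by
    rw [integrable_prod_iff hF.aestronglyMeasurable]
    refine ⟨(ae_restrict_iff' hs).2 (ae_of_all _ fun x hx => (hg x hx).1), ?_⟩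
    refine hA.1.congr ((ae_restrict_iff' hs).2 (ae_of_all _ fun x hx => ?_))
    simp only [Function.uncurry]
    rw [← (hg x hx).2]
    refine setIntegral_congr_fun ht fun y hy => ?_
    exact (Real.norm_of_nonneg (h0 x hx y hy)).symm
  have hhae : (fun y => ∫ x in s, F x y) =ᵐ[volume.restrict t] h :=
    (ae_restrict_iff' ht).2 (ae_of_all _ fun y hy => (hh y hy).2)
  refine ⟨hint.integral_prod_right.congr hhae, ?_⟩
  rw [← integral_congr_ae hhae, ← integral_integral_swap hint, ← hA.2]
  exact setIntegral_congr_fun hs fun x hx => (hg x hx).2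

end HasIntegralOn

/-! ### Explicit integrals: Gamma, Beta, Frullani and relatives -/

theorem hasIntegralOn_rpow_mul_exp {a r : ℝ} (ha : 0 < a) (hr : 0 < r) :
    HasIntegralOn (fun v => v ^ (a - 1) * Real.exp (-(r * v))) (Ioi 0)
      (r ^ (-a) * Real.Gamma a) := by
  have h := Real.integral_rpow_mul_exp_neg_mul_Ioi ha hr
  -- A non-integrable function has Bochner integral 0, so a nonzero value already forces
  -- integrability.
  have hpos : (1 / r) ^ a * Real.Gamma a ≠ 0 := by
    have := Real.Gamma_pos_of_pos ha
    positivity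
  refine ⟨?_, ?_⟩
  · by_contra hcon
    rw [← h] at hpos
    exact hpos (integral_undef hcon)
  · rw [h, one_div, Real.inv_rpow hr.le, Real.rpow_neg hr.le]

theorem hasIntegralOn_rpow_Ioc {p t : ℝ} (hp : -1 < p) (ht : 0 < t) :
    HasIntegralOn (fun r => r ^ p) (Ioc 0 t) (t ^ (p + 1) / (p + 1)) := by
  refine ⟨(intervalIntegrable_iff_integrableOn_Ioc_of_le ht.le).1
    (intervalIntegral.intervalIntegrable_rpow' hp), ?_⟩
  rw [← intervalIntegral.integral_of_le ht.le, integral_rpow (Or.inl hp),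
    Real.zero_rpow (by linarith), sub_zero]

/-- Nonnegativity of the derivative makes integrability automatic, even when `f'` is singular at an
endpoint. -/
theorem hasIntegralOn_of_hasDerivAt {f f' : ℝ → ℝ} {t : ℝ} (ht : 0 < t)
    (hc : ContinuousOn f (Icc 0 t)) (hd : ∀ x ∈ Ioo 0 t, HasDerivAt f (f' x) x)
    (h0 : ∀ x ∈ Ioo 0 t, 0 ≤ f' x) : HasIntegralOn f' (Ioc 0 t) (f t - f 0) := by
  have h := intervalIntegral.integrableOn_deriv_of_nonneg hc hd h0
  refine ⟨h, ?_⟩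
  rw [← intervalIntegral.integral_of_le ht.le]
  exact intervalIntegral.integral_eq_sub_of_hasDerivAt_of_le ht.le hc hd
    ((intervalIntegrable_iff_integrableOn_Ioc_of_le ht.le).2 h)

/-- `∫₀ᵗ r^p log r dr`, for `0 < t ≤ 1`. -/
theorem hasIntegralOn_rpow_mul_log {p t : ℝ} (hp : -1 < p) (ht : 0 < t) (ht1 : t ≤ 1) :
    HasIntegralOn (fun r => r ^ p * Real.log r) (Ioc 0 t)
      (t ^ (p + 1) * Real.log t / (p + 1) - t ^ (p + 1) / (p + 1) ^ 2) := by
  have hp1 : 0 < p + 1 := by linarith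
  -- The sign is flipped because the logarithm is nonpositive for t ≤ 1, and the criterion used
  -- needs a nonnegative derivative.
  have key : HasIntegralOn (fun r => -(r ^ p * Real.log r)) (Ioc 0 t)
      ((fun r => -(r ^ (p + 1) * Real.log r / (p + 1)) + r ^ (p + 1) / (p + 1) ^ 2) t -
       (fun r => -(r ^ (p + 1) * Real.log r / (p + 1)) + r ^ (p + 1) / (p + 1) ^ 2) 0) := by
    refine hasIntegralOn_of_hasDerivAt
      (f := fun r => -(r ^ (p + 1) * Real.log r / (p + 1)) + r ^ (p + 1) / (p + 1) ^ 2)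
      ht ?_ ?_ ?_
    · have h1 : ContinuousOn (fun r : ℝ => r ^ (p + 1)) (Icc 0 t) :=
        (Real.continuous_rpow_const hp1.le).continuousOn
      have h2 : ContinuousOn (fun r : ℝ => r ^ (p + 1) * Real.log r) (Icc 0 t) := by
        intro x hx
        rcases eq_or_lt_of_le hx.1 with rfl | hx0
        · have := tendsto_log_mul_rpow_nhdsGT_zero hp1
          have h3 : ContinuousWithinAt (fun r : ℝ => r ^ (p + 1) * Real.log r) (Ioi 0) 0 := by
            simp only [ContinuousWithinAt, Real.log_zero, mul_zero]
            simpa only [mul_comm] using this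
          refine (continuousWithinAt_Ioi_iff_Ici.1 h3).mono Icc_subset_Ici_self
        · exact ((Real.continuous_rpow_const hp1.le).continuousAt.mul
            (Real.continuousAt_log hx0.ne')).continuousWithinAt
      exact (h2.div_const _).neg.add (h1.div_const _)
    · intro x hx
      have h1 := Real.hasDerivAt_rpow_const (p := p + 1) (Or.inl hx.1.ne')
      have h2 := Real.hasDerivAt_log hx.1.ne'
      convert! ((h1.mul h2).div_const (p + 1)).neg.add (h1.div_const ((p + 1) ^ 2)) using 1
      rw [Real.rpow_add hx.1, Real.rpow_one]
      have := hx.1.ne'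
      rw [show p + 1 - 1 = p by ring]
      field_simp
      ring
    · intro x hx
      have : Real.log x ≤ 0 := Real.log_nonpos hx.1.le (hx.2.le.trans ht1)
      have : 0 ≤ x ^ p := Real.rpow_nonneg hx.1.le _
      nlinarith
  refine ((key.const_mul (-1)).congr measurableSet_Ioc fun x _ => by ring).congr_val ?_
  simp only [Real.zero_rpow hp1.ne', Real.log_zero]
  ring

/-- The Beta integral over the half-line, with a scale parameter. -/
theorem hasIntegralOn_beta {p q θ : ℝ} (hp : 0 < p) (hq : 0 < q) (hθ : 0 < θ) :
    HasIntegralOn (fun v => v ^ (p - 1) * (θ + v) ^ (-(p + q))) (Ioi 0)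
      (θ ^ (-q) * (Real.Gamma p * Real.Gamma q / Real.Gamma (p + q))) := by
  have hG : 0 < Real.Gamma (p + q) := Real.Gamma_pos_of_pos (by linarith)
  have h1 := (hasIntegralOn_rpow_mul_exp hq hθ).const_mul (Real.Gamma p)
  have h2 : HasIntegralOn (fun v => v ^ (p - 1) * ((θ + v) ^ (-(p + q)) * Real.Gamma (p + q)))
      (Ioi 0) (Real.Gamma p * (θ ^ (-q) * Real.Gamma q)) := by
    -- The factor (θ+v)^{-(p+q)} Γ(p+q) is itself a Gamma integral in u. Integrating over v first
    -- leaves the Gamma integral `h1`.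
    refine h1.swap (F := fun u v => u ^ (p + q - 1) * Real.exp (-((θ + v) * u)) * v ^ (p - 1))
      measurableSet_Ioi measurableSet_Ioi (by unfold Function.uncurry; fun_prop) ?_ ?_ ?_
    · intro x hx y hy
      have := mem_Ioi.1 hx
      have := mem_Ioi.1 hy
      positivity
    · intro u hu
      have hu := mem_Ioi.1 hu
      refine (((hasIntegralOn_rpow_mul_exp hp hu).const_mul
        (u ^ (p + q - 1) * Real.exp (-(θ * u)))).congr measurableSet_Ioi ?_).congr_val ?_
      · intro v _
        simp only [show -((θ + v) * u) = -(θ * u) + -(u * v) by ring, Real.exp_add]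
        ring
      · rw [show q - 1 = (p + q - 1) + (-p) by ring, Real.rpow_add hu]
        ring
    · intro v hv
      have hv := mem_Ioi.1 hv
      refine (((hasIntegralOn_rpow_mul_exp (show 0 < p + q by linarith)
        (show 0 < θ + v by linarith)).const_mul
        (v ^ (p - 1))).congr measurableSet_Ioi ?_)
      intro u _
      ring
  refine ((h2.const_mul (Real.Gamma (p + q))⁻¹).congr measurableSet_Ioi ?_).congr_val ?_
  · intro v _
    field_simp
  · field_simp

theorem hasIntegralOn_exp_Ioc {v r : ℝ} (hv : 0 < v) (hr : 0 < r) :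
    HasIntegralOn (fun θ => Real.exp (-(θ * v))) (Ioc 0 r) ((1 - Real.exp (-(r * v))) / v) := by
  refine (hasIntegralOn_of_hasDerivAt (f := fun θ => -Real.exp (-(θ * v)) / v) hr ?_ ?_ ?_).congr_val
    ?_
  · fun_prop
  · intro x _
    have h : HasDerivAt (fun θ : ℝ => -(θ * v)) (-v) x := by
      simpa using ((hasDerivAt_id x).mul_const v).fun_neg
    convert! (h.exp.neg.div_const v) using 1
    field_simp
  · intro x _
    positivity
  · simp
    ring

/-- Since (1 - e^{-rv})/v = ∫₀ʳ e^{-θv} dθ, Tonelli leaves Γ(1-ε) ∫₀ʳ θ^{ε-1} dθ. This is the error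
integral for the power-law majorants below. -/
theorem hasIntegralOn_rpow_mul_one_sub_exp {ε r : ℝ} (h0 : 0 < ε) (h1 : ε < 1) (hr : 0 < r) :
    HasIntegralOn (fun v => v ^ (-1 - ε) * (1 - Real.exp (-(r * v)))) (Ioi 0)
      (Real.Gamma (1 - ε) * (r ^ ε / ε)) := by
  have hA := ((hasIntegralOn_rpow_Ioc (p := ε - 1) (by linarith) hr).const_mul
    (Real.Gamma (1 - ε))).congr_val (B := Real.Gamma (1 - ε) * (r ^ ε / ε)) (by simp)
  refine (hA.swap (F := fun θ v => v ^ (-ε) * Real.exp (-(θ * v))) (t := Ioi 0)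
    (h := fun v => v ^ (-ε) * ((1 - Real.exp (-(r * v))) / v))
    measurableSet_Ioc measurableSet_Ioi (by unfold Function.uncurry; fun_prop) ?_ ?_ ?_).congr
    measurableSet_Ioi ?_
  · intro x hx y hy
    have := mem_Ioi.1 hy
    positivity
  · intro θ hθ
    refine ((hasIntegralOn_rpow_mul_exp (show 0 < 1 - ε by linarith) hθ.1).congr measurableSet_Ioi
      ?_).congr_val ?_
    · intro v _
      rw [show 1 - ε - 1 = -ε by ring]
    · rw [show -(1 - ε) = ε - 1 by ring, mul_comm]
  · intro v hv
    exact (hasIntegralOn_exp_Ioc hv hr).const_mul _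
  · intro v hv
    have hv := mem_Ioi.1 hv
    rw [show -1 - ε = -ε + -1 by ring, Real.rpow_add hv, Real.rpow_neg_one]
    field_simp

/-- A Frullani integral. -/
theorem hasIntegralOn_frullani {r : ℝ} (hr : 0 < r) :
    HasIntegralOn (fun v => (1 - Real.exp (-v)) / v * Real.exp (-(r * v))) (Ioi 0)
      (Real.log (1 + r) - Real.log r) := by
  have hA : HasIntegralOn (fun θ => (θ + r)⁻¹) (Ioc 0 1) (Real.log (1 + r) - Real.log r) := by
    refine (hasIntegralOn_of_hasDerivAt (f := fun θ => Real.log (θ + r)) one_pos ?_ ?_ ?_).congr_val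
      (by simp)
    · intro x hx
      exact ((continuousAt_id.add continuousAt_const).log (show x + r ≠ 0 by
        linarith [hx.1])).continuousWithinAt
    · intro x hx
      convert! ((hasDerivAt_id x).add_const r).log (by simp only [id]; linarith [hx.1]) using 1
      simp
    · intro x hx
      have := hx.1
      positivity
  refine hA.swap (F := fun θ v => Real.exp (-(θ * v)) * Real.exp (-(r * v)))
    measurableSet_Ioc measurableSet_Ioi (by unfold Function.uncurry; fun_prop) ?_ ?_ ?_
  · intro x hx y hy
    positivity
  · intro θ hθ
    have hθ := hθ.1
    refine ((hasIntegralOn_rpow_mul_exp one_pos (show 0 < θ + r by linarith)).congr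
      measurableSet_Ioi ?_).congr_val ?_
    · intro v _
      rw [← Real.exp_add]
      simp
      ring
    · simp [Real.rpow_neg_one]
  · intro v hv
    have h := (hasIntegralOn_exp_Ioc hv one_pos).const_mul (Real.exp (-(r * v)))
    refine (h.congr measurableSet_Ioc fun x _ => by ring).congr_val ?_
    simp
    ring

theorem hasIntegralOn_log_one_add_sub_log {r : ℝ} (hr : 0 < r) :
    HasIntegralOn (fun θ => Real.log (1 + θ) - Real.log θ) (Ioc 0 r)
      ((1 + r) * Real.log (1 + r) - r * Real.log r) := by
  refine (hasIntegralOn_of_hasDerivAt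
    (f := fun θ => (1 + θ) * Real.log (1 + θ) - θ * Real.log θ) hr ?_ ?_ ?_).congr_val (by simp)
  · have h := Real.continuous_mul_log
    exact ((h.comp (continuous_const.add continuous_id)).sub h).continuousOn
  · intro x hx
    have hx := hx.1
    have h1 := (Real.hasDerivAt_mul_log (x := 1 + x) (by linarith)).comp_const_add 1 x
    have h2 := Real.hasDerivAt_mul_log hx.ne'
    convert! h1.sub h2 using 1
    ring
  · intro x hx
    have := Real.log_le_log hx.1 (show x ≤ 1 + x by linarith)
    linarith

/-- The Frullani integral is integrated over its parameter from 0 to r. The value is of order r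
log(1/r), the source of the logarithmic error terms. -/
theorem hasIntegralOn_one_sub_exp_mul_one_sub_exp {r : ℝ} (hr : 0 < r) :
    HasIntegralOn (fun v => (1 - Real.exp (-v)) * (1 - Real.exp (-(r * v))) / v ^ 2) (Ioi 0)
      ((1 + r) * Real.log (1 + r) - r * Real.log r) := by
  refine (hasIntegralOn_log_one_add_sub_log hr).swap
    (F := fun θ v => (1 - Real.exp (-v)) / v * Real.exp (-(θ * v)))
    measurableSet_Ioc measurableSet_Ioi (by unfold Function.uncurry; fun_prop) ?_ ?_ ?_
  · intro x hx v hv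
    have hv := mem_Ioi.1 hv
    have : 0 ≤ 1 - Real.exp (-v) := by
      have := Real.exp_le_one_iff.2 (show -v ≤ 0 by linarith)
      linarith
    positivity
  · intro θ hθ
    exact hasIntegralOn_frullani hθ.1
  · intro v hv
    have := mem_Ioi.1 hv
    refine ((hasIntegralOn_exp_Ioc hv hr).const_mul ((1 - Real.exp (-v)) / v)).congr_val ?_
    field_simp

/-- The analytic continuation of the Beta integral to the strip `a - 1 < c < a`. -/
theorem hasIntegralOn_rpow_mul_sub {a c : ℝ} (hc : 0 < c) (h1 : a - 1 < c) (h2 : c < a) :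
    HasIntegralOn (fun v => v ^ (a - 1) * (v ^ (-c) - (1 + v) ^ (-c))) (Ioi 0)
      (-(Real.Gamma a * Real.Gamma (c - a) / Real.Gamma c)) := by
  have ha : 0 < a := hc.trans h2
  have hA := ((hasIntegralOn_rpow_Ioc (p := a - c - 1) (by linarith) one_pos).const_mul
    (c * (Real.Gamma a * Real.Gamma (c + 1 - a) / Real.Gamma (c + 1)))).congr_val
      (B := -(Real.Gamma a * Real.Gamma (c - a) / Real.Gamma c)) (by
        rw [show c + 1 - a = (c - a) + 1 by ring, Real.Gamma_add_one (by linarith),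
          Real.Gamma_add_one hc.ne', Real.one_rpow]
        have := Real.Gamma_pos_of_pos hc
        have : a - c - 1 + 1 ≠ 0 := by linarith
        field_simp
        ring)
  -- The difference v^{-c} - (1+v)^{-c} equals ∫₀¹ c (θ+v)^{-c-1} dθ. For fixed θ the v-integral is
  -- a genuine Beta integral with q = c + 1 - a > 0.
  refine hA.swap (F := fun θ v => c * (v ^ (a - 1) * (θ + v) ^ (-(a + (c + 1 - a)))))
    measurableSet_Ioc measurableSet_Ioi (by unfold Function.uncurry; fun_prop) ?_ ?_ ?_
  · intro x hx v hv
    have := mem_Ioi.1 hv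
    have := hx.1
    positivity
  · intro θ hθ
    refine ((hasIntegralOn_beta ha (show 0 < c + 1 - a by linarith) hθ.1).const_mul c).congr_val ?_
    rw [show -(c + 1 - a) = a - c - 1 by ring, show a + (c + 1 - a) = c + 1 by ring]
    ring
  · intro v hv
    have hv := mem_Ioi.1 hv
    have h := hasIntegralOn_of_hasDerivAt (f := fun θ => -(v ^ (a - 1) * (θ + v) ^ (-c)))
      (f' := fun θ => c * (v ^ (a - 1) * (θ + v) ^ (-(a + (c + 1 - a))))) one_pos ?_ ?_ ?_
    · refine h.congr_val ?_
      simp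
      ring
    · intro x hx
      have : x + v ≠ 0 := by linarith [hx.1]
      exact (((continuousAt_id.add continuousAt_const).rpow_const
        (Or.inl this)).const_mul _).neg.continuousWithinAt
    · intro x hx
      have hxv : x + v ≠ 0 := by linarith [hx.1]
      convert! ((((hasDerivAt_id x).add_const v).rpow_const (p := -c) (Or.inl hxv)).const_mul
        (v ^ (a - 1))).neg using 1
      rw [show -(a + (c + 1 - a)) = -c - 1 by ring]
      simp only [id]
      ring
    · intro x hx
      have := hx.1
      positivity

/-! ### The critical case c = a: the logarithmic kernel and its integral -/

theorem one_sub_exp_neg_nonneg {x : ℝ} (hx : 0 ≤ x) : 0 ≤ 1 - Real.exp (-x) := by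
  have := Real.exp_le_one_iff.2 (show -x ≤ 0 by linarith)
  linarith

theorem inv_one_add_le_one_sub_exp_div {v : ℝ} (hv : 0 < v) :
    (1 + v)⁻¹ ≤ (1 - Real.exp (-v)) / v := by
  have h1 : Real.exp (-v) ≤ (1 + v)⁻¹ := by
    rw [Real.exp_neg]
    exact inv_anti₀ (by linarith) (by linarith [Real.add_one_le_exp v])
  rw [le_div_iff₀ hv]
  have : (1 + v)⁻¹ * v = 1 - (1 + v)⁻¹ := by
    field_simp
    ring
  linarith

theorem abs_inv_one_add_sub_le {v : ℝ} (hv : 0 < v) :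
    |(1 + v)⁻¹ - (1 - Real.exp (-v)) / v| ≤ 2 * (1 + v) ^ (-(1 + 1) : ℝ) := by
  rw [abs_of_nonpos (sub_nonpos.2 (inv_one_add_le_one_sub_exp_div hv))]
  have h2 : (1 + v) ^ (-(1 + 1) : ℝ) = ((1 + v) ^ 2)⁻¹ := by
    rw [Real.rpow_neg (by linarith), ← Real.rpow_natCast]
    norm_num
  have h3 : 1 - (1 + v) * Real.exp (-v) ≤ 2 * v / (1 + v) := by
    rw [le_div_iff₀ (by linarith)]
    have e1 := Real.add_one_le_exp (-v)
    have e0 := Real.exp_pos (-v)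
    -- For v ≥ 1 the right side is at least 1. For v ≤ 1 the bound 1 - v ≤ e^{-v} is enough.
    rcases le_total v 1 with h | h
    · nlinarith [mul_le_mul_of_nonneg_left e1 (show 0 ≤ (1 + v) ^ 2 by positivity),
        mul_nonneg hv.le (mul_nonneg (sub_nonneg.2 h) (show 0 ≤ 2 + v by linarith))]
    · nlinarith [mul_nonneg (show 0 ≤ (1 + v) ^ 2 by positivity) e0.le]
  rw [h2]
  have h4 : -((1 + v)⁻¹ - (1 - Real.exp (-v)) / v) =
      (1 - (1 + v) * Real.exp (-v)) / (v * (1 + v)) := by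
    field_simp
    ring
  rw [h4, div_le_iff₀ (by positivity)]
  refine h3.trans (le_of_eq ?_)
  field_simp

/-- The factor 1 - x records the vanishing at x = 1, and 1 + x^p allows for the blow-up at 0 when p
< 0. With x = v/(1+v), where 1 - x = 1/(1+v), it supplies the extra decay in v. -/
theorem abs_rpow_sub_one_le {p x : ℝ} (hp : -1 < p) (h0 : 0 < x) (h1 : x < 1) :
    |x ^ p - 1| ≤ (|p| + 1) * ((1 - x) * (1 + x ^ p)) := by
  have hxp : 0 < x ^ p := Real.rpow_pos_of_pos h0 p
  have h1x : 0 < 1 - x := by linarith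
  rcases le_total 0 p with hp0 | hp0
  · have hle : x ^ p ≤ 1 := Real.rpow_le_one h0.le h1.le hp0
    have key : 1 - x ^ p ≤ (p + 1) * (1 - x) := by
      rcases le_total 1 p with hp1 | hp1
      · have := one_add_mul_self_le_rpow_one_add (s := x - 1) (by linarith) hp1
        rw [show 1 + (x - 1) = x by ring] at this
        nlinarith
      · have := Real.rpow_le_rpow_of_exponent_ge h0 h1.le hp1
        rw [Real.rpow_one] at this
        nlinarith
    rw [abs_of_nonpos (by linarith), abs_of_nonneg hp0]
    have : 0 ≤ (p + 1) * (1 - x) * x ^ p := by positivity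
    nlinarith
  · have h2 : x ≤ x ^ (-p) := by
      have := Real.rpow_le_rpow_of_exponent_ge h0 h1.le (show -p ≤ 1 by linarith)
      rwa [Real.rpow_one] at this
    have h3 : x ^ p * x ^ (-p) = 1 := by rw [← Real.rpow_add h0]; simp
    have h4 : 1 ≤ x ^ p := Real.one_le_rpow_of_pos_of_le_one_of_nonpos h0 h1.le hp0
    rw [abs_of_nonneg (by linarith), abs_of_nonpos hp0]
    have h5 : x ^ p - 1 ≤ x ^ p * (1 - x) := by nlinarith
    have : 0 ≤ -p * ((1 - x) * (1 + x ^ p)) :=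
      mul_nonneg (by linarith) (by positivity)
    nlinarith

/-- The difference between the critical Beta integrand `v^{a-1} (1+v)^{-a}`, which has a
logarithmically divergent integral, and the Frullani integrand `(1 - e^{-v}) / v`. -/
def logKernel (a v : ℝ) : ℝ := v ^ (a - 1) * (1 + v) ^ (-a) - (1 - Real.exp (-v)) / v

theorem measurable_logKernel (a : ℝ) : Measurable (logKernel a) := by
  unfold logKernel
  fun_prop

/-- Both terms of the kernel are compared with 1/(1+v). The two errors are bounded by convergent
Beta integrands. -/
theorem abs_logKernel_le {a v : ℝ} (ha : 0 < a) (hv : 0 < v) :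
    |logKernel a v| ≤ (|a - 1| + 3) * (v ^ (a - 1) * (1 + v) ^ (-(a + 1)) +
      v ^ (1 - 1 : ℝ) * (1 + v) ^ (-(1 + 1) : ℝ)) := by
  have hv1 : 0 < 1 + v := by linarith
  have hx := abs_rpow_sub_one_le (p := a - 1) (x := v / (1 + v)) (by linarith) (by positivity)
    ((div_lt_one hv1).2 (by linarith))
  have e1 : v ^ (a - 1) * (1 + v) ^ (-a) - (1 + v)⁻¹ =
      ((v / (1 + v)) ^ (a - 1) - 1) * (1 + v)⁻¹ := by
    rw [Real.div_rpow hv.le hv1.le, sub_mul, one_mul, div_mul_eq_mul_div, mul_div_assoc,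
      show -a = -1 - (a - 1) by ring, Real.rpow_sub hv1, Real.rpow_neg_one]
  have e2 : 1 - v / (1 + v) = (1 + v)⁻¹ := by
    field_simp
    ring
  have e3 : (1 + v) ^ (-(1 + 1) : ℝ) = (1 + v)⁻¹ * (1 + v)⁻¹ := by
    rw [show (-(1 + 1) : ℝ) = -1 + -1 by ring, Real.rpow_add hv1, Real.rpow_neg_one]
  have e4 : v ^ (a - 1) * (1 + v) ^ (-(a + 1)) =
      (1 + v)⁻¹ * (1 + v)⁻¹ * (v / (1 + v)) ^ (a - 1) := by
    rw [Real.div_rpow hv.le hv1.le, show -(a + 1) = -1 + -1 + -(a - 1) by ring,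
      Real.rpow_add hv1, Real.rpow_add hv1, Real.rpow_neg_one, Real.rpow_neg hv1.le (a - 1)]
    ring
  have b1 : |v ^ (a - 1) * (1 + v) ^ (-a) - (1 + v)⁻¹| ≤
      (|a - 1| + 1) * (v ^ (a - 1) * (1 + v) ^ (-(a + 1)) + (1 + v) ^ (-(1 + 1) : ℝ)) := by
    rw [e1, abs_mul, abs_of_pos (inv_pos.2 hv1), e4, e3]
    rw [e2] at hx
    calc _ ≤ _ := mul_le_mul_of_nonneg_right hx (inv_pos.2 hv1).le
      _ = _ := by ring
  have b2 := abs_inv_one_add_sub_le hv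
  have b3 : logKernel a v = (v ^ (a - 1) * (1 + v) ^ (-a) - (1 + v)⁻¹) +
      ((1 + v)⁻¹ - (1 - Real.exp (-v)) / v) := by
    unfold logKernel
    ring
  rw [b3, sub_self, Real.rpow_zero, one_mul]
  refine (abs_add_le _ _).trans ((add_le_add b1 b2).trans ?_)
  have : 0 ≤ v ^ (a - 1) * (1 + v) ^ (-(a + 1)) := by positivity
  nlinarith

/-- Multiplied by 1 - e^{-rv}, the right side has an explicit integral. It therefore serves as
majorant in both borderline cases c = a and c = a + 1. -/
theorem rpow_mul_rpow_le_one_sub_exp_div_sq {b v : ℝ} (hb : 0 ≤ b) (hv : 0 < v) :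
    v ^ (b - 1) * (1 + v) ^ (-(b + 1)) ≤ (1 - Real.exp (-v)) / v ^ 2 := by
  have hv1 : 0 < 1 + v := by linarith
  have h1 : v ^ (b - 1) * (1 + v) ^ (-(b + 1)) = (v / (1 + v)) ^ b * ((1 + v)⁻¹ / v) := by
    rw [Real.div_rpow hv.le hv1.le, Real.rpow_sub_one hv.ne', show -(b + 1) = -b + -1 by ring,
      Real.rpow_add hv1, Real.rpow_neg_one, Real.rpow_neg hv1.le]
    field_simp
  have h2 : (v / (1 + v)) ^ b ≤ 1 :=
    Real.rpow_le_one (by positivity) ((div_le_one hv1).2 (by linarith)) hb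
  have h3 := inv_one_add_le_one_sub_exp_div hv
  rw [h1]
  calc _ ≤ 1 * ((1 - Real.exp (-v)) / v / v) := by gcongr
    _ = _ := by
      field_simp

theorem integrableOn_rpow_mul_one_add_rpow {p q : ℝ} (hp : 0 < p) (hq : 0 < q) :
    IntegrableOn (fun v : ℝ => v ^ (p - 1) * (1 + v) ^ (-(p + q))) (Ioi 0) :=
  (hasIntegralOn_beta hp hq one_pos).1

/-- The factor v^{-ε} makes the two terms of the kernel converge separately, one to a Beta value and
the other to Γ(1-ε)/ε. -/
theorem hasIntegralOn_rpow_mul_logKernel {a ε : ℝ} (h0 : 0 < ε) (h1 : ε < 1) (ha : ε < a) :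
    HasIntegralOn (fun v => v ^ (-ε) * logKernel a v) (Ioi 0)
      (ε⁻¹ * (Real.Gamma (a - ε) * Real.Gamma (1 + ε) / Real.Gamma a - Real.Gamma (1 - ε))) := by
  refine (((hasIntegralOn_beta (show 0 < a - ε by linarith) h0 one_pos).sub
    (hasIntegralOn_rpow_mul_one_sub_exp h0 h1 one_pos)).congr measurableSet_Ioi ?_).congr_val ?_
  · intro v hv
    have hv := mem_Ioi.1 hv
    rw [logKernel, show a - ε - 1 = -ε + (a - 1) by ring, Real.rpow_add hv,
      show -1 - ε = -ε + -1 by ring, Real.rpow_add hv, Real.rpow_neg_one,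
      show a - ε + ε = a by ring, one_mul]
    ring
  · rw [Real.one_rpow, Real.one_rpow, add_comm 1 ε, Real.Gamma_add_one h0.ne',
      show a - ε + ε = a by ring]
    field_simp

theorem rpow_neg_le_one_add {v ε δ : ℝ} (hv : 0 < v) (h0 : 0 ≤ ε) (h1 : ε ≤ δ) :
    v ^ (-ε) ≤ 1 + v ^ (-δ) := by
  have hd : 0 < v ^ (-δ) := Real.rpow_pos_of_pos hv _
  rcases le_total 1 v with h | h
  · have := Real.rpow_le_one_of_one_le_of_nonpos h (show -ε ≤ 0 by linarith)
    linarith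
  · have := Real.rpow_le_rpow_of_exponent_ge hv h (show -δ ≤ -ε by linarith)
    linarith

theorem digamma_eq {a : ℝ} (ha : 0 < a) :
    digamma a = deriv Real.Gamma a / Real.Gamma a := by
  have hd : DifferentiableAt ℝ Real.Gamma a :=
    Real.differentiableAt_Gamma fun m => by
      have : (0 : ℝ) ≤ m := m.cast_nonneg
      linarith
  exact (hd.hasDerivAt.log (Real.Gamma_pos_of_pos ha).ne').deriv

/-- Let ε → 0 in the regularized integral. Its value is the difference quotient at 0 of φ(ε) =
Γ(a-ε)Γ(1+ε)/Γ(a) - Γ(1-ε). Here φ(0) = 0, and Γ'(1) = -γ enters twice in φ'(0). -/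
theorem hasIntegralOn_logKernel {a : ℝ} (ha : 0 < a) :
    HasIntegralOn (logKernel a) (Ioi 0)
      (-digamma a - 2 * Real.eulerMascheroniConstant) := by
  -- With δ < min(a, 1), the weight 1 + v^{-δ} dominates v^{-ε} for every ε in [0, δ] and keeps the
  -- majorant integrable at 0.
  obtain ⟨δ, hδ0, hδ⟩ := exists_between (lt_min ha one_pos)
  have hδa : δ < a := hδ.trans_le (min_le_left _ _)
  have hδ1 : δ < 1 := hδ.trans_le (min_le_right _ _)
  have hw : ∀ b, δ < b → IntegrableOn
      (fun v : ℝ => (1 + v ^ (-δ)) * (v ^ (b - 1) * (1 + v) ^ (-(b + 1)))) (Ioi 0) := by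
    intro b hb
    refine ((integrableOn_rpow_mul_one_add_rpow (hδ0.trans hb) one_pos).add
      (integrableOn_rpow_mul_one_add_rpow (p := b - δ) (q := 1 + δ) (by linarith)
      (by linarith))).congr_fun ?_ measurableSet_Ioi
    intro v hv
    simp only [Pi.add_apply]
    rw [show b - δ - 1 = -δ + (b - 1) by ring, Real.rpow_add (mem_Ioi.1 hv),
      show b - δ + (1 + δ) = b + 1 by ring]
    ring
  have hbound : IntegrableOn (fun v : ℝ => (1 + v ^ (-δ)) *
      ((|a - 1| + 3) * (v ^ (a - 1) * (1 + v) ^ (-(a + 1)) +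
      v ^ (1 - 1 : ℝ) * (1 + v) ^ (-(1 + 1) : ℝ)))) (Ioi 0) := by
    have h := ((hw a hδa).add (hw 1 hδ1)).const_mul (|a - 1| + 3)
    refine IntegrableOn.congr_fun h ?_ measurableSet_Ioi
    intro v _
    simp only [Pi.add_apply]
    ring
  have hdom : ∀ ε, 0 ≤ ε → ε ≤ δ → ∀ v ∈ Ioi (0 : ℝ), ‖v ^ (-ε) * logKernel a v‖ ≤
      (1 + v ^ (-δ)) * ((|a - 1| + 3) * (v ^ (a - 1) * (1 + v) ^ (-(a + 1)) +
      v ^ (1 - 1 : ℝ) * (1 + v) ^ (-(1 + 1) : ℝ))) := by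
    intro ε h0 h1 v hv
    have hv := mem_Ioi.1 hv
    rw [Real.norm_eq_abs, abs_mul, abs_of_pos (Real.rpow_pos_of_pos hv _)]
    have := Real.rpow_pos_of_pos hv (-δ)
    exact mul_le_mul (rpow_neg_le_one_add hv h0 h1) (abs_logKernel_le ha hv) (abs_nonneg _)
      (by linarith)
  have hmeas := measurable_logKernel a
  have hInt : IntegrableOn (logKernel a) (Ioi 0) := by
    refine Integrable.mono' hbound hmeas.aestronglyMeasurable
      ((ae_restrict_iff' measurableSet_Ioi).2 (ae_of_all _ fun v hv => ?_))
    simpa using hdom 0 le_rfl hδ0.le v hv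
  refine ⟨hInt, ?_⟩
  have hev : ∀ᶠ ε : ℝ in 𝓝[>] 0, 0 < ε ∧ ε ≤ δ :=
    Ioc_mem_nhdsGT hδ0
  have lim1 : Tendsto (fun ε : ℝ => ∫ v in Ioi 0, v ^ (-ε) * logKernel a v) (𝓝[>] 0)
      (𝓝 (∫ v in Ioi 0, logKernel a v)) := by
    refine tendsto_integral_filter_of_dominated_convergence _ ?_ ?_ hbound ?_
    · exact Eventually.of_forall fun ε => (by fun_prop : Measurable _).aestronglyMeasurable
    · filter_upwards [hev] with ε hε
      exact (ae_restrict_iff' measurableSet_Ioi).2 (ae_of_all _ fun v hv =>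
        hdom ε hε.1.le hε.2 v hv)
    · refine (ae_restrict_iff' measurableSet_Ioi).2 (ae_of_all _ fun v hv => ?_)
      have hc : Continuous fun ε : ℝ => v ^ (-ε) * logKernel a v :=
        (Real.continuous_const_rpow (mem_Ioi.1 hv).ne' |>.comp continuous_neg).mul continuous_const
      simpa using (hc.tendsto 0).mono_left (nhdsWithin_le_nhds (s := Ioi 0))
  have hGa := Real.Gamma_pos_of_pos ha
  have hda : HasDerivAt Real.Gamma (deriv Real.Gamma a) (a - 0) := by
    rw [sub_zero]
    exact (Real.differentiableAt_Gamma fun m => by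
      have : (0 : ℝ) ≤ m := m.cast_nonneg
      linarith).hasDerivAt
  have hφ : HasDerivAt (fun ε => Real.Gamma (a - ε) * Real.Gamma (1 + ε) / Real.Gamma a -
      Real.Gamma (1 - ε)) (-digamma a - 2 * Real.eulerMascheroniConstant) 0 := by
    have d1 := hda.comp_const_sub a 0
    have d2 := (show HasDerivAt Real.Gamma (-Real.eulerMascheroniConstant) (1 + 0) by
      simpa using Real.hasDerivAt_Gamma_one).comp_const_add 1 0
    have d3 := (show HasDerivAt Real.Gamma (-Real.eulerMascheroniConstant) (1 - 0) by
      simpa using Real.hasDerivAt_Gamma_one).comp_const_sub 1 0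
    convert! ((d1.mul d2).div_const (Real.Gamma a)).sub d3 using 1
    rw [digamma_eq ha]
    simp
    field_simp
    ring
  have lim2 := (hasDerivAt_iff_tendsto_slope.1 hφ).mono_left
    (nhdsWithin_mono 0 (fun x (hx : x ∈ Ioi (0 : ℝ)) => (mem_Ioi.1 hx).ne'))
  refine tendsto_nhds_unique lim1 (lim2.congr' ?_)
  filter_upwards [hev] with ε hε
  rw [(hasIntegralOn_rpow_mul_logKernel hε.1 (hε.2.trans_lt hδ1) (hε.2.trans_lt hδa)).2,
    slope_def_field]
  simp [hGa.ne']
  ring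

/-! ### The Kummer integral: measurability and two-sided bounds -/

/-- `∫₀^∞ v^{a-1} (1+v)^{-c} e^{-rv} dv`, which is `Γ(a) U(a, a - c + 1, r)` for Kummer's confluent
hypergeometric function `U`. -/
def kummer (a c r : ℝ) : ℝ :=
  ∫ v in Ioi (0 : ℝ), v ^ (a - 1) * (1 + v) ^ (-c) * Real.exp (-(r * v))

theorem hasIntegralOn_kummer {a c r : ℝ} (ha : 0 < a) (hc : 0 ≤ c) (hr : 0 < r) :
    HasIntegralOn (fun v => v ^ (a - 1) * (1 + v) ^ (-c) * Real.exp (-(r * v))) (Ioi 0)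
      (kummer a c r) := by
  refine ⟨?_, rfl⟩
  refine Integrable.mono' (hasIntegralOn_rpow_mul_exp ha hr).1
    (by fun_prop : Measurable _).aestronglyMeasurable
    ((ae_restrict_iff' measurableSet_Ioi).2 (ae_of_all _ fun v hv => ?_))
  have hv := mem_Ioi.1 hv
  rw [Real.norm_of_nonneg (by positivity), mul_assoc]
  have h1 : (1 + v) ^ (-c) ≤ 1 :=
    Real.rpow_le_one_of_one_le_of_nonpos (by linarith) (by linarith)
  have h2 := Real.exp_pos (-(r * v))
  gcongr
  nlinarith

theorem measurable_kummer (a c : ℝ) : Measurable (kummer a c) := by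
  have h : StronglyMeasurable (Function.uncurry
      fun r v : ℝ => v ^ (a - 1) * (1 + v) ^ (-c) * Real.exp (-(r * v))) := by
    refine Measurable.stronglyMeasurable ?_
    unfold Function.uncurry
    fun_prop
  exact (h.integral_prod_right (ν := volume.restrict (Ioi 0))).measurable

theorem kummer_nonneg (a c r : ℝ) : 0 ≤ kummer a c r :=
  setIntegral_nonneg measurableSet_Ioi fun v hv => by
    have := mem_Ioi.1 hv
    positivity

theorem kummer_pos {a c r : ℝ} (ha : 0 < a) (hc : 0 ≤ c) (hr : 0 < r) : 0 < kummer a c r := by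
  have h := hasIntegralOn_kummer ha hc hr
  unfold kummer
  rw [setIntegral_pos_iff_support_of_nonneg_ae ?_ h.1]
  · refine lt_of_lt_of_le (b := volume (Ioi (0 : ℝ))) (by simp) (measure_mono fun v hv => ⟨?_, hv⟩)
    have := mem_Ioi.1 hv
    exact (by positivity : v ^ (a - 1) * (1 + v) ^ (-c) * Real.exp (-(r * v)) ≠ 0)
  · refine (ae_restrict_iff' measurableSet_Ioi).2 (ae_of_all _ fun v hv => ?_)
    have := mem_Ioi.1 hv
    exact (by positivity : 0 ≤ v ^ (a - 1) * (1 + v) ^ (-c) * Real.exp (-(r * v)))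

/-- Weakening (1+v)^{-c} to v^{-c'} leaves a Gamma integral. The free exponent c' also covers c ≥ a,
where c itself is not allowed. -/
theorem kummer_le {a c c' r : ℝ} (hc' : 0 ≤ c') (hcc : c' ≤ c) (hca : c' < a) (hr : 0 < r) :
    kummer a c r ≤ r ^ (-(a - c')) * Real.Gamma (a - c') := by
  refine (hasIntegralOn_kummer (by linarith) (by linarith) hr).mono_val
    (hasIntegralOn_rpow_mul_exp (show 0 < a - c' by linarith) hr) measurableSet_Ioi fun v hv => ?_
  have hv := mem_Ioi.1 hv
  have h1 : (1 + v) ^ (-c) ≤ v ^ (-c') :=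
    (Real.rpow_le_rpow_of_exponent_le (by linarith) (by linarith)).trans
      (Real.rpow_le_rpow_of_nonpos hv (by linarith) (by linarith : -c' ≤ 0))
  rw [show a - c' - 1 = a - 1 + -c' by ring, Real.rpow_add hv]
  gcongr

theorem kummer_one_le {a c r : ℝ} (ha : 0 < a) (hc : 0 ≤ c) (hr : 0 < r) (hr1 : r ≤ 1) :
    kummer a c 1 ≤ kummer a c r := by
  refine (hasIntegralOn_kummer ha hc one_pos).mono_val (hasIntegralOn_kummer ha hc hr)
    measurableSet_Ioi fun v hv => ?_
  have := mem_Ioi.1 hv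
  gcongr

/-- Substituting v = w/r extracts r^{c-a} and turns 1 + v into (r + w)/r. Then (r+w)^{-c} ≥
(1+w)^{-c} because r ≤ 1. -/
theorem rpow_mul_kummer_one_le {a c r : ℝ} (ha : 0 < a) (hc : 0 ≤ c) (hr : 0 < r) (hr1 : r ≤ 1) :
    r ^ (c - a) * kummer a c 1 ≤ kummer a c r := by
  have hinv : 0 < r⁻¹ := inv_pos.2 hr
  have hK := hasIntegralOn_kummer (r := r) ha hc hr
  have hscale : HasIntegralOn (fun w => r⁻¹ * ((r⁻¹ * w) ^ (a - 1) * (1 + r⁻¹ * w) ^ (-c) *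
      Real.exp (-(r * (r⁻¹ * w))))) (Ioi 0) (kummer a c r) := by
    refine ⟨?_, ?_⟩
    · refine Integrable.const_mul ?_ _
      have := (integrableOn_Ioi_comp_mul_left_iff
        (fun v => v ^ (a - 1) * (1 + v) ^ (-c) * Real.exp (-(r * v))) 0 hinv).2
        (by simpa using hK.1)
      exact this
    · rw [integral_const_mul]
      have := integral_comp_mul_left_Ioi'
        (fun v => v ^ (a - 1) * (1 + v) ^ (-c) * Real.exp (-(r * v))) 0 hinv
      simpa [kummer] using this
  refine ((hasIntegralOn_kummer ha hc one_pos).const_mul (r ^ (c - a))).mono_val hscale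
    measurableSet_Ioi fun w hw => ?_
  have hw := mem_Ioi.1 hw
  have e1 : 1 + r⁻¹ * w = r⁻¹ * (r + w) := by field_simp
  have e2 : r * (r⁻¹ * w) = 1 * w := by field_simp
  have e3 : r⁻¹ * ((r⁻¹) ^ (a - 1) * (r⁻¹) ^ (-c)) = r ^ (c - a) := by
    rw [Real.inv_rpow hr.le, Real.inv_rpow hr.le, ← Real.rpow_neg hr.le, ← Real.rpow_neg hr.le,
      ← Real.rpow_neg_one, ← Real.rpow_add hr, ← Real.rpow_add hr]
    ring_nf
  rw [e1, e2, Real.mul_rpow hinv.le hw.le, Real.mul_rpow hinv.le (by linarith), ← e3]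
  have h1 : (1 + w) ^ (-c) ≤ (r + w) ^ (-c) :=
    Real.rpow_le_rpow_of_nonpos (by linarith) (by linarith) (by linarith)
  calc _ = (r⁻¹ * ((r⁻¹) ^ (a - 1) * (r⁻¹) ^ (-c))) * (w ^ (a - 1) * (1 + w) ^ (-c) *
        Real.exp (-(1 * w))) := rfl
    _ ≤ (r⁻¹ * ((r⁻¹) ^ (a - 1) * (r⁻¹) ^ (-c))) * (w ^ (a - 1) * (r + w) ^ (-c) *
        Real.exp (-(1 * w))) := by gcongr
    _ = _ := by ring

/-! ### Expansions of the Kummer integral as r → 0 -/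

/-- Inserting `e^{-rv}` into a convergent integral of `f` changes it by at most `∫ G`, if
`|f v| (1 - e^{-rv}) ≤ G v`. -/
theorem exists_hasIntegralOn_mul_exp {f G : ℝ → ℝ} {r A B : ℝ} (hf : HasIntegralOn f (Ioi 0) A)
    (hr : 0 < r) (hG : HasIntegralOn G (Ioi 0) B)
    (hfG : ∀ v, 0 < v → |f v| * (1 - Real.exp (-(r * v))) ≤ G v) :
    ∃ I, HasIntegralOn (fun v => f v * Real.exp (-(r * v))) (Ioi 0) I ∧ |I - A| ≤ B := by
  have hint : IntegrableOn (fun v => f v * Real.exp (-(r * v))) (Ioi 0) := by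
    refine Integrable.mono' hf.1.norm (hf.1.aestronglyMeasurable.mul
      (by fun_prop : Measurable _).aestronglyMeasurable)
      ((ae_restrict_iff' measurableSet_Ioi).2 (ae_of_all _ fun v hv => ?_))
    have := mem_Ioi.1 hv
    rw [norm_mul, Real.norm_of_nonneg (Real.exp_pos _).le]
    exact mul_le_of_le_one_right (norm_nonneg _) (Real.exp_le_one_iff.2 (by
      have : 0 ≤ r * v := by positivity
      linarith))
  refine ⟨_, ⟨hint, rfl⟩, ?_⟩
  have hd := HasIntegralOn.sub ⟨hint, rfl⟩ hf
  rw [← hd.2, ← hG.2, ← Real.norm_eq_abs]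
  refine norm_integral_le_of_norm_le hG.1
    ((ae_restrict_iff' measurableSet_Ioi).2 (ae_of_all _ fun v hv => ?_))
  have hv := mem_Ioi.1 hv
  refine le_trans (le_of_eq ?_) (hfG v hv)
  have h0 := one_sub_exp_neg_nonneg (show 0 ≤ r * v by positivity)
  rw [show f v * Real.exp (-(r * v)) - f v = -(f v * (1 - Real.exp (-(r * v)))) by ring, norm_neg,
    norm_mul, Real.norm_of_nonneg h0, Real.norm_eq_abs]

theorem rpow_neg_sub_le {c v : ℝ} (hc : 0 ≤ c) (hv : 0 < v) :
    v ^ (-c) - (1 + v) ^ (-c) ≤ c * v ^ (-c - 1) := by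
  have hy : 0 < 1 + v⁻¹ := by positivity
  have e1 : 1 + v = v * (1 + v⁻¹) := by
    field_simp
    ring
  have h1 : 1 - c * v⁻¹ ≤ (1 + v⁻¹) ^ (-c) := by
    rw [Real.rpow_def_of_pos hy]
    have h2 := Real.add_one_le_exp (Real.log (1 + v⁻¹) * -c)
    have h3 := Real.log_le_sub_one_of_pos hy
    have : c * Real.log (1 + v⁻¹) ≤ c * v⁻¹ := by gcongr; linarith
    linarith
  rw [e1, Real.mul_rpow hv.le hy.le, Real.rpow_sub_one hv.ne', div_eq_mul_inv]
  have := Real.rpow_pos_of_pos hv (-c)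
  nlinarith

/-- Replacing (1+v)^{-c} by v^{-c} gives the singular term exactly. The correction converges at r =
0 since c > a - 1, and v^{-c} - (1+v)^{-c} ≤ c v^{-c-1} controls its dependence on r. -/
theorem abs_kummer_sub_le_of_lt {a c r : ℝ} (hc : 0 < c) (h1 : a - 1 < c) (h2 : c < a)
    (hr : 0 < r) :
    |kummer a c r - (Real.Gamma (a - c) * r ^ (c - a) +
      Real.Gamma a * Real.Gamma (c - a) / Real.Gamma c)| ≤
      c * (Real.Gamma (a - c) / (1 + c - a)) * r ^ (1 + c - a) := by
  obtain ⟨I, hI, hle⟩ := exists_hasIntegralOn_mul_exp (hasIntegralOn_rpow_mul_sub hc h1 h2) hr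
    ((hasIntegralOn_rpow_mul_one_sub_exp (ε := 1 + c - a) (by linarith) (by linarith) hr).const_mul
      c) (by
      intro v hv
      have h0 := one_sub_exp_neg_nonneg (show 0 ≤ r * v by positivity)
      have h3 : (1 + v) ^ (-c) ≤ v ^ (-c) :=
        Real.rpow_le_rpow_of_nonpos hv (by linarith) (by linarith)
      have h4 := rpow_neg_sub_le hc.le hv
      rw [abs_of_nonneg (mul_nonneg (by positivity) (by linarith)), ← mul_assoc]
      refine mul_le_mul_of_nonneg_right ?_ h0
      rw [show -1 - (1 + c - a) = (a - 1) + (-c - 1) by ring, Real.rpow_add hv]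
      have := Real.rpow_pos_of_pos hv (a - 1)
      nlinarith)
  have hK : kummer a c r = Real.Gamma (a - c) * r ^ (c - a) - I := by
    have h := (hasIntegralOn_rpow_mul_exp (show 0 < a - c by linarith) hr).sub hI
    rw [show Real.Gamma (a - c) * r ^ (c - a) = r ^ (-(a - c)) * Real.Gamma (a - c) by
      rw [mul_comm, neg_sub], ← h.2, kummer]
    refine setIntegral_congr_fun measurableSet_Ioi fun v hv => ?_
    rw [show a - c - 1 = (a - 1) + -c by ring, Real.rpow_add (mem_Ioi.1 hv)]
    ring
  rw [hK, abs_sub_comm, show ∀ x y z : ℝ, x + y - (x - z) = z - -y by intros; ring]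
  refine hle.trans (le_of_eq ?_)
  rw [show 1 - (1 + c - a) = a - c by ring]
  ring

theorem one_add_mul_log_le {r : ℝ} (hr : 0 < r) (hr1 : r ≤ 1) :
    (1 + r) * Real.log (1 + r) - r * Real.log r ≤ r * (2 - Real.log r) := by
  have := Real.log_le_sub_one_of_pos (show 0 < 1 + r by linarith)
  nlinarith

/-- The integrand is `logKernel` plus the Frullani integrand, and the latter contributes log(1+r) -
log r. The term log(1+r) ≤ r is absorbed into the error. -/
theorem abs_kummer_sub_le_of_eq {a r : ℝ} (ha : 0 < a) (hr : 0 < r) (hr1 : r ≤ 1) :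
    |kummer a a r - (-Real.log r - digamma a - 2 * Real.eulerMascheroniConstant)| ≤
      (2 * (|a - 1| + 3) + 1) * (r * (2 - Real.log r)) := by
  obtain ⟨I, hI, hle⟩ := exists_hasIntegralOn_mul_exp (hasIntegralOn_logKernel ha) hr
    ((hasIntegralOn_one_sub_exp_mul_one_sub_exp hr).const_mul (2 * (|a - 1| + 3))) (by
      intro v hv
      have h0 := one_sub_exp_neg_nonneg (show 0 ≤ r * v by positivity)
      have h1 := abs_logKernel_le ha hv
      have h2 := rpow_mul_rpow_le_one_sub_exp_div_sq ha.le hv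
      have h3 := rpow_mul_rpow_le_one_sub_exp_div_sq zero_le_one hv
      have h4 : |logKernel a v| ≤ 2 * (|a - 1| + 3) * ((1 - Real.exp (-v)) / v ^ 2) := by
        refine h1.trans ?_
        have := abs_nonneg (a - 1)
        nlinarith
      calc _ ≤ _ := mul_le_mul_of_nonneg_right h4 h0
        _ = _ := by ring)
  have hK : kummer a a r = I + (Real.log (1 + r) - Real.log r) := by
    rw [← (hI.add (hasIntegralOn_frullani hr)).2, kummer]
    refine setIntegral_congr_fun measurableSet_Ioi fun v _ => ?_
    simp only [logKernel]
    ring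
  have hl0 := Real.log_nonneg (show 1 ≤ 1 + r by linarith)
  have hl1 := Real.log_le_sub_one_of_pos (show 0 < 1 + r by linarith)
  have hl2 := Real.log_nonpos hr.le hr1
  have hb := one_add_mul_log_le hr hr1
  have h5 : |Real.log (1 + r)| ≤ r * (2 - Real.log r) := by
    rw [abs_of_nonneg hl0]
    nlinarith
  rw [hK, show I + (Real.log (1 + r) - Real.log r) -
    (-Real.log r - digamma a - 2 * Real.eulerMascheroniConstant) =
    (I - (-digamma a - 2 * Real.eulerMascheroniConstant)) + Real.log (1 + r) by ring]
  have h6 := mul_le_mul_of_nonneg_left hb (show 0 ≤ 2 * (|a - 1| + 3) by positivity)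
  exact (abs_add_le _ _).trans (by linarith)

/-- For c > a the Beta integral converges at r = 0. Only the majorant `G` depends on the position of
c relative to a + 1. -/
theorem abs_kummer_sub_le_of_gt {a c r B : ℝ} {G : ℝ → ℝ} (ha : 0 < a) (hac : a < c) (hr : 0 < r)
    (hG : HasIntegralOn G (Ioi 0) B)
    (hfG : ∀ v, 0 < v → v ^ (a - 1) * (1 + v) ^ (-c) * (1 - Real.exp (-(r * v))) ≤ G v) :
    |kummer a c r - Real.Gamma a * Real.Gamma (c - a) / Real.Gamma c| ≤ B := by
  have hf := hasIntegralOn_beta ha (show 0 < c - a by linarith) one_pos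
  rw [Real.one_rpow, one_mul, add_sub_cancel] at hf
  obtain ⟨I, hI, hle⟩ := exists_hasIntegralOn_mul_exp hf hr hG (by
    intro v hv
    rw [abs_of_nonneg (by positivity)]
    exact hfG v hv)
  rwa [kummer, hI.2]

theorem abs_kummer_sub_le_of_lt_add_one {a c r : ℝ} (ha : 0 < a) (hac : a < c) (hca : c < a + 1)
    (hr : 0 < r) :
    |kummer a c r - Real.Gamma a * Real.Gamma (c - a) / Real.Gamma c| ≤
      Real.Gamma (1 - (c - a)) / (c - a) * r ^ (c - a) := by
  refine (abs_kummer_sub_le_of_gt ha hac hr (hasIntegralOn_rpow_mul_one_sub_exp (ε := c - a)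
    (by linarith) (by linarith) hr) fun v hv => ?_).trans (le_of_eq (by ring))
  have h0 := one_sub_exp_neg_nonneg (show 0 ≤ r * v by positivity)
  refine mul_le_mul_of_nonneg_right ?_ h0
  rw [show -1 - (c - a) = (a - 1) + -c by ring, Real.rpow_add hv]
  have : (1 + v) ^ (-c) ≤ v ^ (-c) :=
    Real.rpow_le_rpow_of_nonpos hv (by linarith) (by linarith)
  gcongr

theorem abs_kummer_sub_le_of_eq_add_one {a r : ℝ} (ha : 0 < a) (hr : 0 < r) (hr1 : r ≤ 1) :
    |kummer a (a + 1) r - Real.Gamma a * Real.Gamma (a + 1 - a) / Real.Gamma (a + 1)| ≤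
      r * (2 - Real.log r) := by
  refine (abs_kummer_sub_le_of_gt ha (by linarith) hr
    (hasIntegralOn_one_sub_exp_mul_one_sub_exp hr) fun v hv => ?_).trans (one_add_mul_log_le hr hr1)
  have h0 := one_sub_exp_neg_nonneg (show 0 ≤ r * v by positivity)
  rw [mul_div_right_comm]
  exact mul_le_mul_of_nonneg_right (rpow_mul_rpow_le_one_sub_exp_div_sq ha.le hv) h0

/-- Here the first moment of v^{a-1} (1+v)^{-c} is finite, so 1 - e^{-rv} ≤ rv gives a linear error.
-/
theorem abs_kummer_sub_le_of_add_one_lt {a c r : ℝ} (ha : 0 < a) (hac : a + 1 < c) (hr : 0 < r) :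
    |kummer a c r - Real.Gamma a * Real.Gamma (c - a) / Real.Gamma c| ≤
      Real.Gamma (a + 1) * Real.Gamma (c - (a + 1)) / Real.Gamma c * r := by
  have hf := hasIntegralOn_beta (show 0 < a + 1 by linarith) (show 0 < c - (a + 1) by linarith)
    one_pos
  rw [Real.one_rpow, one_mul, add_sub_cancel] at hf
  refine (abs_kummer_sub_le_of_gt ha (by linarith) hr (hf.const_mul r) fun v hv => ?_).trans
    (le_of_eq (by ring))
  have h1 := Real.one_sub_le_exp_neg (r * v)
  rw [show a + 1 - 1 = (a - 1) + 1 by ring, Real.rpow_add hv, Real.rpow_one]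
  have h2 : 0 ≤ v ^ (a - 1) * (1 + v) ^ (-c) := by positivity
  nlinarith

/-! ### Fourier transform of the Bessel kernel -/

theorem integral_gaussian_mul_exp_inner {d : ℕ} {u : ℝ} (hu : 0 < u)
    (ξ : EuclideanSpace ℝ (Fin d)) :
    ∫ x : EuclideanSpace ℝ (Fin d), Complex.exp (-(Complex.I * ((inner ℝ x ξ : ℝ) : ℂ))) *
      ((Real.exp (-(‖x‖ ^ 2 / (4 * u))) : ℝ) : ℂ) =
      (((4 * Real.pi * u) ^ ((d : ℝ) / 2) * Real.exp (-(u * ‖ξ‖ ^ 2)) : ℝ) : ℂ) := by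
  have hb : 0 < (((1 / (4 * u) : ℝ)) : ℂ).re := by
    rw [Complex.ofReal_re]
    positivity
  have h := GaussianFourier.integral_cexp_neg_mul_sq_norm_add hb (-Complex.I) ξ
  calc _ = ∫ x : EuclideanSpace ℝ (Fin d), Complex.exp (-((1 / (4 * u) : ℝ) : ℂ) *
        (‖x‖ : ℂ) ^ 2 + -Complex.I * ((inner ℝ ξ x : ℝ) : ℂ)) := by
        refine integral_congr_ae (ae_of_all _ fun x => ?_)
        simp only [Complex.ofReal_exp]
        rw [← Complex.exp_add, real_inner_comm]
        congr 1
        push_cast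
        ring
    _ = _ := by
        rw [h, finrank_euclideanSpace_fin]
        push_cast
        rw [Complex.ofReal_cpow (by positivity)]
        congr 1
        · congr 1
          · push_cast
            have : (u : ℂ) ≠ 0 := by exact_mod_cast hu.ne'
            field_simp
          · push_cast
            ring
        · congr 1
          have : (u : ℂ) ≠ 0 := by exact_mod_cast hu.ne'
          rw [neg_sq, Complex.I_sq]
          field_simp

theorem integral_gaussian {d : ℕ} {u : ℝ} (hu : 0 < u) :
    ∫ x : EuclideanSpace ℝ (Fin d), Real.exp (-(‖x‖ ^ 2 / (4 * u))) =
      (4 * Real.pi * u) ^ ((d : ℝ) / 2) := by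
  have h := GaussianFourier.integral_rexp_neg_mul_sq_norm (V := EuclideanSpace ℝ (Fin d))
    (show 0 < 1 / (4 * u) by positivity)
  rw [finrank_euclideanSpace_fin] at h
  convert h using 2
  · ext x
    congr 1
    ring
  · field_simp

theorem integrable_gaussian {d : ℕ} {u : ℝ} (hu : 0 < u) :
    Integrable fun x : EuclideanSpace ℝ (Fin d) => Real.exp (-(‖x‖ ^ 2 / (4 * u))) := by
  by_contra hcon
  have h := integral_gaussian (d := d) hu
  rw [integral_undef hcon] at h
  have : 0 < (4 * Real.pi * u) ^ ((d : ℝ) / 2) := by positivity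
  linarith

theorem rpow_mul_gaussian_mass {d : ℕ} {s u : ℝ} (hu : 0 < u) (y : ℝ) :
    Real.exp (-u) * u ^ ((s - d) / 2 - 1) *
      ((4 * Real.pi * u) ^ ((d : ℝ) / 2) * Real.exp (-(u * y))) =
    (4 * Real.pi) ^ ((d : ℝ) / 2) * (u ^ (s / 2 - 1) * Real.exp (-((1 + y) * u))) := by
  rw [Real.mul_rpow (by positivity) hu.le, show s / 2 - 1 = ((s - d) / 2 - 1) + (d : ℝ) / 2 by ring,
    Real.rpow_add hu, show -((1 + y) * u) = -u + -(u * y) by ring, Real.exp_add]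
  ring

theorem fourierTransform_besselKernel {d : ℕ} {s : ℝ} (hs : 0 < s)
    (ξ : EuclideanSpace ℝ (Fin d)) :
    fourierTransform (besselKernel d s) ξ = (((1 + ‖ξ‖ ^ 2) ^ (-(s / 2)) : ℝ) : ℂ) := by
  set C : ℝ := ((4 * Real.pi) ^ ((d : ℝ) / 2) * Real.Gamma (s / 2))⁻¹ with hC
  have hΓ : 0 < Real.Gamma (s / 2) := Real.Gamma_pos_of_pos (by linarith)
  have hgam : ∀ y : ℝ, 0 ≤ y → HasIntegralOn (fun u => Real.exp (-u) * u ^ ((s - d) / 2 - 1) *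
      ((4 * Real.pi * u) ^ ((d : ℝ) / 2) * Real.exp (-(u * y)))) (Ioi 0)
      ((4 * Real.pi) ^ ((d : ℝ) / 2) * ((1 + y) ^ (-(s / 2)) * Real.Gamma (s / 2))) := by
    intro y hy
    refine ((hasIntegralOn_rpow_mul_exp (show 0 < s / 2 by linarith)
      (show 0 < 1 + y by linarith)).const_mul ((4 * Real.pi) ^ ((d : ℝ) / 2))).congr
      measurableSet_Ioi fun u hu => ?_
    exact (rpow_mul_gaussian_mass hu y).symm
  let F : EuclideanSpace ℝ (Fin d) → ℝ → ℂ := fun x u =>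
    Complex.exp (-(Complex.I * ((inner ℝ x ξ : ℝ) : ℂ))) *
      ((Real.exp (-(‖x‖ ^ 2 / (4 * u))) : ℝ) : ℂ) *
      ((Real.exp (-u) * u ^ ((s - d) / 2 - 1) : ℝ) : ℂ)
  have hnorm1 : ∀ x, ‖Complex.exp (-(Complex.I * ((inner ℝ x ξ : ℝ) : ℂ)))‖ = 1 := by
    intro x
    rw [Complex.norm_exp]
    simp
  have hmeas : Measurable (Function.uncurry F) := by
    unfold F Function.uncurry
    fun_prop
  have hxint : ∀ u ∈ Ioi (0 : ℝ), Integrable fun x => F x u := by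
    intro u hu
    refine Integrable.mul_const ?_ _
    refine (integrable_gaussian (d := d) hu).mono' (by fun_prop : Measurable _).aestronglyMeasurable
      (ae_of_all _ fun x => ?_)
    rw [norm_mul, hnorm1, one_mul, Complex.norm_real, Real.norm_of_nonneg (Real.exp_pos _).le]
  have hFint : Integrable (Function.uncurry F) (volume.prod (volume.restrict (Ioi 0))) := by
    rw [integrable_prod_iff' hmeas.aestronglyMeasurable]
    refine ⟨(ae_restrict_iff' measurableSet_Ioi).2 (ae_of_all _ hxint), ?_⟩
    -- Absolute convergence is the frequency-zero case: the phase has modulus 1, so the integral of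
    -- the norm is the total Gaussian mass.
    refine (hgam 0 le_rfl).1.congr
      ((ae_restrict_iff' measurableSet_Ioi).2 (ae_of_all _ fun u hu => ?_))
    have hu := mem_Ioi.1 hu
    simp only [Function.uncurry, F]
    rw [mul_zero, neg_zero, Real.exp_zero, mul_one, ← integral_gaussian (d := d) hu, mul_comm,
      ← integral_mul_const]
    refine integral_congr_ae (ae_of_all _ fun x => ?_)
    simp only
    rw [norm_mul, norm_mul, hnorm1, one_mul, Complex.norm_real, Complex.norm_real,
      Real.norm_of_nonneg (Real.exp_pos _).le, Real.norm_of_nonneg (by positivity)]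
  have hswap := integral_integral_swap hFint
  have hleft : fourierTransform (besselKernel d s) ξ =
      (C : ℂ) * ∫ x, ∫ u in Ioi (0 : ℝ), F x u := by
    unfold fourierTransform besselKernel
    rw [← integral_const_mul]
    refine integral_congr_ae (ae_of_all _ fun x => ?_)
    simp only [F]
    rw [← hC, Complex.ofReal_mul, mul_left_comm]
    congr 1
    rw [← integral_complex_ofReal, ← integral_const_mul]
    refine setIntegral_congr_fun measurableSet_Ioi fun u _ => ?_
    rw [mul_assoc, ← Complex.ofReal_mul, ← mul_assoc (Real.exp (-(‖x‖ ^ 2 / (4 * u)))),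
      ← Real.exp_add, show -(‖x‖ ^ 2 / (4 * u)) + -u = -u - ‖x‖ ^ 2 / (4 * u) by ring]
  have hright : ∫ u in Ioi (0 : ℝ), ∫ x, F x u =
      (((4 * Real.pi) ^ ((d : ℝ) / 2) *
        ((1 + ‖ξ‖ ^ 2) ^ (-(s / 2)) * Real.Gamma (s / 2)) : ℝ) : ℂ) := by
    rw [← (hgam (‖ξ‖ ^ 2) (by positivity)).2, ← integral_complex_ofReal]
    refine setIntegral_congr_fun measurableSet_Ioi fun u hu => ?_
    simp only [F]
    rw [integral_mul_const, integral_gaussian_mul_exp_inner hu, ← Complex.ofReal_mul, mul_comm]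
  rw [hleft, hswap, hright, ← Complex.ofReal_mul, hC]
  congr 1
  have : 0 < (4 * Real.pi) ^ ((d : ℝ) / 2) := by positivity
  field_simp

/-! ### Radial integration and the value of Υ_α(0) -/

/-- Integration of radial functions on `ℝ^d` in the variable `v = ‖ξ‖²`. -/
theorem lintegral_normSq {d : ℕ} (hd : 1 ≤ d) {f : ℝ → ℝ} {A : ℝ}
    (hf : HasIntegralOn (fun v => v ^ ((d : ℝ) / 2 - 1) * f v) (Ioi 0) A)
    (h0 : ∀ v, 0 ≤ v → 0 ≤ f v) :
    ∫⁻ ξ : EuclideanSpace ℝ (Fin d), ENNReal.ofReal (f (‖ξ‖ ^ 2)) =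
      ENNReal.ofReal (Real.pi ^ ((d : ℝ) / 2) / Real.Gamma ((d : ℝ) / 2) * A) := by
  have hne : Nonempty (Fin d) := ⟨⟨0, hd⟩⟩
  have hsub : ∀ y ∈ Ioi (0 : ℝ), ((|(2 : ℝ)| * y ^ ((2 : ℝ) - 1)) •
      ((y ^ (2 : ℝ)) ^ ((d : ℝ) / 2 - 1) * f (y ^ (2 : ℝ)))) =
      2 * (y ^ (d - 1) • f (y ^ 2)) := by
    intro y hy
    have hy := mem_Ioi.1 hy
    rw [← Real.rpow_mul hy.le, abs_two, smul_eq_mul, smul_eq_mul, ← Real.rpow_natCast y (d - 1),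
      Nat.cast_sub hd, ← Real.rpow_natCast y 2]
    have : y ^ ((d : ℝ) - (1 : ℕ)) = y ^ ((2 : ℝ) - 1) * y ^ ((2 : ℝ) * ((d : ℝ) / 2 - 1)) := by
      rw [← Real.rpow_add hy]
      congr 1
      push_cast
      ring
    rw [this]
    push_cast
    ring
  have hint : Integrable fun ξ : EuclideanSpace ℝ (Fin d) => f (‖ξ‖ ^ 2) := by
    rw [integrable_fun_norm_addHaar volume (f := fun y => f (y ^ 2)), finrank_euclideanSpace_fin]
    have h1 := (integrableOn_Ioi_comp_rpow_iff (fun v => v ^ ((d : ℝ) / 2 - 1) * f v)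
      (two_ne_zero (α := ℝ))).2 hf.1
    have h2 := (h1.congr_fun hsub measurableSet_Ioi).const_mul (1 / 2 : ℝ)
    refine Integrable.congr h2 (ae_of_all _ fun y => ?_)
    simp only
    ring
  have hvol : (volume : Measure (EuclideanSpace ℝ (Fin d))).real (Metric.ball 0 1) =
      Real.pi ^ ((d : ℝ) / 2) / Real.Gamma ((d : ℝ) / 2 + 1) := by
    rw [Measure.real, EuclideanSpace.volume_ball]
    have : 0 < Real.Gamma ((d : ℝ) / 2 + 1) := Real.Gamma_pos_of_pos (by positivity)
    simp only [ENNReal.ofReal_one, one_pow, one_mul, Fintype.card_fin]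
    rw [ENNReal.toReal_ofReal (by positivity), Real.sqrt_eq_rpow, ← Real.rpow_natCast,
      ← Real.rpow_mul Real.pi_pos.le]
    congr 2
    ring
  rw [← ofReal_integral_eq_lintegral_ofReal hint (ae_of_all _ fun ξ => h0 _ (by positivity)),
    integral_fun_norm_addHaar volume (fun y => f (y ^ 2)), finrank_euclideanSpace_fin, hvol]
  congr 1
  have h3 := integral_comp_rpow_Ioi (fun v => v ^ ((d : ℝ) / 2 - 1) * f v)
    (two_ne_zero (α := ℝ))
  rw [hf.2, setIntegral_congr_fun measurableSet_Ioi hsub, integral_const_mul] at h3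
  have hd0 : (0 : ℝ) < (d : ℝ) / 2 := by
    have : (1 : ℝ) ≤ d := by exact_mod_cast hd
    linarith
  have hG := Real.Gamma_pos_of_pos hd0
  rw [← h3, Real.Gamma_add_one hd0.ne', nsmul_eq_mul, smul_eq_mul]
  field_simp

theorem lintegral_spectralMeasure {d : ℕ} {s : ℝ} (hs : 0 < s)
    {g : EuclideanSpace ℝ (Fin d) → ENNReal} (hg : Measurable g) :
    ∫⁻ ξ, g ξ ∂(spectralMeasure (besselKernel d s)) =
      ∫⁻ ξ, ENNReal.ofReal ((1 + ‖ξ‖ ^ 2) ^ (-(s / 2))) * g ξ := by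
  unfold spectralMeasure
  simp only [fourierTransform_besselKernel hs, Complex.ofReal_re]
  rw [lintegral_withDensity_eq_lintegral_mul _ (by fun_prop) hg]
  rfl

theorem upsilon_besselKernel {d : ℕ} (hd : 1 ≤ d) {s α : ℝ} (hs : 0 < s)
    (h1 : 0 < (d : ℝ) - 2 * (1 - α)) (h2 : (d : ℝ) - 2 * (1 - α) < s) :
    upsilon (spectralMeasure (besselKernel d s)) α 0 =
      ENNReal.ofReal
        (Real.Gamma ((d : ℝ) / 2 - 1 + α) * Real.Gamma ((s - d) / 2 + 1 - α) /
          (2 ^ d * Real.pi ^ ((d : ℝ) / 2) * Real.Gamma ((d : ℝ) / 2) * Real.Gamma (s / 2))) := by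
  have hne : Nonempty (Fin d) := ⟨⟨0, hd⟩⟩
  have hd0 : (0 : ℝ) < (d : ℝ) / 2 := by
    have : (1 : ℝ) ≤ d := by exact_mod_cast hd
    linarith
  have hbeta : HasIntegralOn (fun v => v ^ ((d : ℝ) / 2 - 1) *
      (v ^ (-(1 - α)) * (1 + v) ^ (-(s / 2)))) (Ioi 0)
      (Real.Gamma ((d : ℝ) / 2 - 1 + α) * Real.Gamma ((s - d) / 2 + 1 - α) /
        Real.Gamma (s / 2)) := by
    refine ((hasIntegralOn_beta (p := (d : ℝ) / 2 - 1 + α) (q := (s - d) / 2 + 1 - α)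
      (by linarith) (by linarith) one_pos).congr measurableSet_Ioi fun v hv => ?_).congr_val ?_
    · rw [← mul_assoc, ← Real.rpow_add (mem_Ioi.1 hv)]
      ring_nf
    · rw [Real.one_rpow, one_mul]
      ring_nf
  have hrad := lintegral_normSq hd hbeta (fun v hv => by positivity)
  unfold upsilon
  rw [lintegral_spectralMeasure hs (by fun_prop)]
  -- The identity is only needed almost everywhere. At ξ = 0 the inverse in [0, ∞] and the real
  -- power can differ.
  have hae : ∀ᵐ ξ : EuclideanSpace ℝ (Fin d), ENNReal.ofReal ((1 + ‖ξ‖ ^ 2) ^ (-(s / 2))) *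
      (ENNReal.ofReal (0 + ‖ξ‖ ^ 2) ^ (1 - α))⁻¹ =
      ENNReal.ofReal ((‖ξ‖ ^ 2) ^ (-(1 - α)) * (1 + ‖ξ‖ ^ 2) ^ (-(s / 2))) := by
    filter_upwards [Measure.ae_ne volume (0 : EuclideanSpace ℝ (Fin d))] with ξ hξ
    have hpos : 0 < ‖ξ‖ ^ 2 := by
      have := norm_pos_iff.2 hξ
      positivity
    rw [zero_add, ENNReal.ofReal_rpow_of_pos hpos, ← ENNReal.ofReal_inv_of_pos (by positivity),
      ← ENNReal.ofReal_mul (by positivity), Real.rpow_neg hpos.le, mul_comm]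
  rw [lintegral_congr_ae hae, hrad, ← ENNReal.ofReal_mul (by positivity)]
  congr 1
  have hG := Real.Gamma_pos_of_pos hd0
  have hG2 := Real.Gamma_pos_of_pos (show 0 < s / 2 by linarith)
  have hpi : Real.pi ^ d = Real.pi ^ ((d : ℝ) / 2) * Real.pi ^ ((d : ℝ) / 2) := by
    rw [← Real.rpow_add Real.pi_pos, add_halves, Real.rpow_natCast]
  have : 0 < Real.pi ^ ((d : ℝ) / 2) := by positivity
  rw [mul_pow, hpi]
  field_simp

theorem upsilon_zero_besselKernel {d : ℕ} (hd : 1 ≤ d) {s : ℝ} (hs : 0 < s)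
    (h1 : 0 < (d : ℝ) - 2) (h2 : (d : ℝ) - 2 < s) :
    upsilon (spectralMeasure (besselKernel d s)) 0 0 =
      ENNReal.ofReal
        (Real.Gamma ((2 + s - d) / 2) /
          (2 ^ ((d : ℝ) - 1) * Real.pi ^ ((d : ℝ) / 2) * ((d : ℝ) - 2) *
            Real.Gamma (s / 2))) := by
  rw [upsilon_besselKernel hd hs (by linarith) (by linarith)]
  congr 1
  have hG1 := Real.Gamma_pos_of_pos (show 0 < (d : ℝ) / 2 - 1 by linarith)
  have hG2 := Real.Gamma_pos_of_pos (show 0 < s / 2 by linarith)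
  have hrec : Real.Gamma ((d : ℝ) / 2) = ((d : ℝ) / 2 - 1) * Real.Gamma ((d : ℝ) / 2 - 1) := by
    rw [← Real.Gamma_add_one (by linarith)]
    ring_nf
  rw [hrec, Real.rpow_sub_one two_ne_zero, Real.rpow_natCast, add_zero,
    show (s - d) / 2 + 1 - 0 = (2 + s - d) / 2 by ring]
  have h3 : (d : ℝ) / 2 - 1 ≠ 0 := by linarith
  have h4 : (d : ℝ) - 2 ≠ 0 := h1.ne'
  have : 0 < Real.pi ^ ((d : ℝ) / 2) := by positivity
  rw [show (d : ℝ) / 2 - 1 = ((d : ℝ) - 2) / 2 by ring] at *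
  field_simp

/-! ### Reduction of 𝓗_α to the Kummer integral, and finiteness -/

theorem calH_besselKernel {d : ℕ} (hd : 1 ≤ d) {s : ℝ} (hs : 0 < s) (α t : ℝ) :
    calH (spectralMeasure (besselKernel d s)) α t =
      ∫⁻ r in Ioc (0 : ℝ) t, ENNReal.ofReal (r ^ (-(2 * α)) *
        (Real.pi ^ ((d : ℝ) / 2) / Real.Gamma ((d : ℝ) / 2) * kummer ((d : ℝ) / 2) (s / 2) r)) := by
  have hd0 : (0 : ℝ) < (d : ℝ) / 2 := by
    have : (1 : ℝ) ≤ d := by exact_mod_cast hd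
    linarith
  refine setLIntegral_congr_fun measurableSet_Ioc fun r hr => ?_
  have hr0 := hr.1
  have hK := hasIntegralOn_kummer hd0 (show 0 ≤ s / 2 by linarith) hr0
  rw [ENNReal.ofReal_mul (by positivity), lintegral_spectralMeasure hs (by fun_prop),
    ← lintegral_normSq hd (hK.congr measurableSet_Ioi fun v _ => mul_assoc _ _ _)
      (fun v hv => by positivity)]
  congr 1
  refine lintegral_congr fun ξ => ?_
  rw [ENNReal.ofReal_mul (by positivity)]

theorem calH_lt_top {d : ℕ} (hd : 1 ≤ d) {s α : ℝ} (hs : 0 < s) {t : ℝ} (ht : 0 < t)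
    (h1 : 2 * α < 1) (h2 : 2 * α + ((d : ℝ) - s) / 2 < 1) :
    calH (spectralMeasure (besselKernel d s)) α t < ⊤ := by
  have hd0 : (0 : ℝ) < (d : ℝ) / 2 := by
    have : (1 : ℝ) ≤ d := by exact_mod_cast hd
    linarith
  have hG := Real.Gamma_pos_of_pos hd0
  -- The lower bound d/2 - 1 + 2α < c makes the exponent -2α - (d/2 - c) exceed -1. The other bounds
  -- allow `kummer_le` with c' = c.
  obtain ⟨c, hc1, hc2⟩ := exists_between (show max ((d : ℝ) / 2 - 1 + 2 * α) 0 <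
    min (s / 2) ((d : ℝ) / 2) from max_lt (lt_min (by linarith) (by linarith))
      (lt_min (by linarith) hd0))
  obtain ⟨hc3, hc4⟩ := max_lt_iff.1 hc1
  obtain ⟨hc5, hc6⟩ := lt_min_iff.1 hc2
  rw [calH_besselKernel hd hs]
  have hI := (hasIntegralOn_rpow_Ioc (p := -(2 * α) + -((d : ℝ) / 2 - c)) (by linarith)
    ht).const_mul (Real.pi ^ ((d : ℝ) / 2) / Real.Gamma ((d : ℝ) / 2) *
      Real.Gamma ((d : ℝ) / 2 - c))
  have hGc := Real.Gamma_pos_of_pos (show 0 < (d : ℝ) / 2 - c by linarith)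
  refine lt_of_le_of_lt (setLIntegral_mono' measurableSet_Ioc fun r hr => ?_)
    (lt_of_eq_of_lt (hI.lintegral measurableSet_Ioc fun r hr => ?_) ENNReal.ofReal_lt_top)
  · have hr0 := hr.1
    refine ENNReal.ofReal_le_ofReal ?_
    have := kummer_le hc4.le hc5.le hc6 hr0
    rw [Real.rpow_add hr0]
    calc _ ≤ r ^ (-(2 * α)) * (Real.pi ^ ((d : ℝ) / 2) / Real.Gamma ((d : ℝ) / 2) *
          (r ^ (-((d : ℝ) / 2 - c)) * Real.Gamma ((d : ℝ) / 2 - c))) := by gcongr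
      _ = _ := by ring
  · have := hr.1
    positivity

/-- A lower bound r^q for K makes r^{q-2α} integrable on (0, 1], which happens only for an exponent
above -1. -/
theorem neg_one_lt_of_calH_lt_top {d : ℕ} (hd : 1 ≤ d) {s α k q : ℝ} (hs : 0 < s) (hk : 0 < k)
    (hK : ∀ r, 0 < r → r ≤ 1 → r ^ q * k ≤ kummer ((d : ℝ) / 2) (s / 2) r)
    (hfin : calH (spectralMeasure (besselKernel d s)) α 1 < ⊤) : -1 < -(2 * α) + q := by
  have hd0 : (0 : ℝ) < (d : ℝ) / 2 := by
    have : (1 : ℝ) ≤ d := by exact_mod_cast hd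
    linarith
  have hG := Real.Gamma_pos_of_pos hd0
  set A := Real.pi ^ ((d : ℝ) / 2) / Real.Gamma ((d : ℝ) / 2) with hA
  have hA0 : 0 < A := by positivity
  rw [calH_besselKernel hd hs] at hfin
  rw [← intervalIntegral.integrableOn_Ioo_rpow_iff one_pos, ← integrableOn_Ioc_iff_integrableOn_Ioo]
  have hle : ∫⁻ r in Ioc (0 : ℝ) 1, ENNReal.ofReal (A * k * r ^ (-(2 * α) + q)) ≠ ⊤ := by
    refine (lt_of_le_of_lt (setLIntegral_mono' measurableSet_Ioc fun r hr => ?_) hfin).ne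
    refine ENNReal.ofReal_le_ofReal ?_
    have hr0 := hr.1
    rw [Real.rpow_add hr0]
    calc _ = r ^ (-(2 * α)) * (A * (r ^ q * k)) := by ring
      _ ≤ _ := by
        have := hK r hr.1 hr.2
        gcongr
  have hint := (lintegral_ofReal_ne_top_iff_integrable
    (by fun_prop : Measurable _).aestronglyMeasurable
    ((ae_restrict_iff' measurableSet_Ioc).2 (ae_of_all _ fun r hr => by
      have := hr.1
      exact (by positivity : 0 ≤ A * k * r ^ (-(2 * α) + q))))).1 hle
  refine Integrable.congr (hint.const_mul (A * k)⁻¹) (ae_of_all _ fun r => ?_)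
  have : A * k ≠ 0 := by positivity
  simp only
  field_simp

theorem calH_lt_top_iff {d : ℕ} (hd : 1 ≤ d) {s α : ℝ} (hs : 0 < s) (hα : 0 < α) :
    (∀ t : ℝ, 0 < t → calH (spectralMeasure (besselKernel d s)) α t < ⊤) ↔
      α < 1 / 2 - max ((d : ℝ) - s) 0 / 4 ∧ (d : ℝ) - 2 < s := by
  have hd0 : (0 : ℝ) < (d : ℝ) / 2 := by
    have : (1 : ℝ) ≤ d := by exact_mod_cast hd
    linarith
  have hs2 : 0 ≤ s / 2 := by linarith
  constructor
  · intro h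
    have hfin := h 1 one_pos
    have hk := kummer_pos hd0 hs2 one_pos
    have h1 := neg_one_lt_of_calH_lt_top hd hs hk (q := 0) (fun r hr hr1 => by
      rw [Real.rpow_zero, one_mul]
      exact kummer_one_le hd0 hs2 hr hr1) hfin
    have h2 := neg_one_lt_of_calH_lt_top hd hs hk (q := s / 2 - (d : ℝ) / 2)
      (fun r hr hr1 => rpow_mul_kummer_one_le hd0 hs2 hr hr1) hfin
    -- The exponent (s-d)/2 gives s > d - 2 + 4α, which yields s > d - 2 because α > 0.
    refine ⟨?_, by linarith⟩
    rcases max_choice ((d : ℝ) - s) 0 with hm | hm <;> rw [hm] <;> linarith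
  · rintro ⟨h1, -⟩ t ht
    have h2 := le_max_left ((d : ℝ) - s) 0
    have h3 := le_max_right ((d : ℝ) - s) 0
    exact calH_lt_top hd hs ht (by linarith) (by linarith)

/-! ### Asymptotics of 𝓗_α(t) as t → 0+ -/

/-- A pointwise approximation of the Kummer integral near `0` integrates to one of `𝓗_α`. -/
theorem abs_toReal_calH_sub_le {d : ℕ} (hd : 1 ≤ d) {s α t MI EI : ℝ} {M E : ℝ → ℝ} (hs : 0 < s)
    (ht1 : t ≤ 1)
    (hKM : ∀ r, 0 < r → r ≤ 1 → |kummer ((d : ℝ) / 2) (s / 2) r - M r| ≤ E r)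
    (hM : HasIntegralOn (fun r => r ^ (-(2 * α)) * M r) (Ioc 0 t) MI)
    (hE : HasIntegralOn (fun r => r ^ (-(2 * α)) * E r) (Ioc 0 t) EI) :
    |(calH (spectralMeasure (besselKernel d s)) α t).toReal -
      Real.pi ^ ((d : ℝ) / 2) / Real.Gamma ((d : ℝ) / 2) * MI| ≤
      Real.pi ^ ((d : ℝ) / 2) / Real.Gamma ((d : ℝ) / 2) * EI := by
  have hd0 : (0 : ℝ) < (d : ℝ) / 2 := by
    have : (1 : ℝ) ≤ d := by exact_mod_cast hd
    linarith
  have hG := Real.Gamma_pos_of_pos hd0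
  set A := Real.pi ^ ((d : ℝ) / 2) / Real.Gamma ((d : ℝ) / 2) with hA
  have hA0 : 0 < A := by positivity
  set K := kummer ((d : ℝ) / 2) (s / 2) with hKdef
  have hKm : Measurable K := measurable_kummer _ _
  have hdiff : ∀ r ∈ Ioc 0 t, ‖r ^ (-(2 * α)) * K r - r ^ (-(2 * α)) * M r‖ ≤
      r ^ (-(2 * α)) * E r := by
    intro r hr
    have := hr.1
    rw [← mul_sub, norm_mul, Real.norm_of_nonneg (by positivity), Real.norm_eq_abs]
    exact mul_le_mul_of_nonneg_left (hKM r hr.1 (hr.2.trans ht1)) (by positivity)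
  -- Integrability of the K-term is deduced from that of the approximation and the error, so no
  -- separate finiteness result is needed.
  have hdint : IntegrableOn (fun r => r ^ (-(2 * α)) * K r - r ^ (-(2 * α)) * M r) (Ioc 0 t) :=
    Integrable.mono' hE.1 ((by fun_prop : Measurable fun r : ℝ =>
      r ^ (-(2 * α)) * K r).aestronglyMeasurable.sub hM.1.aestronglyMeasurable)
      ((ae_restrict_iff' measurableSet_Ioc).2 (ae_of_all _ hdiff))
  have hKint : HasIntegralOn (fun r => r ^ (-(2 * α)) * K r) (Ioc 0 t)
      (∫ r in Ioc 0 t, r ^ (-(2 * α)) * K r) :=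
    ⟨(Integrable.add hdint hM.1).congr (ae_of_all _ fun r => by simp), rfl⟩
  have hval : (calH (spectralMeasure (besselKernel d s)) α t).toReal =
      A * ∫ r in Ioc 0 t, r ^ (-(2 * α)) * K r := by
    have hnn : ∀ r ∈ Ioc (0 : ℝ) t, 0 ≤ r ^ (-(2 * α)) * (A * K r) := fun r hr => by
      have := hr.1
      have : 0 ≤ K r := kummer_nonneg _ _ _
      positivity
    have h := ((hKint.const_mul A).congr (g := fun r => r ^ (-(2 * α)) * (A * K r))
      measurableSet_Ioc fun r _ => by ring)
    rw [calH_besselKernel hd hs, h.lintegral measurableSet_Ioc hnn, ENNReal.toReal_ofReal]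
    rw [← h.2]
    exact setIntegral_nonneg measurableSet_Ioc hnn
  rw [hval, ← mul_sub, abs_mul, abs_of_pos hA0]
  refine mul_le_mul_of_nonneg_left ?_ hA0.le
  rw [← (hKint.sub hM).2, ← hE.2, ← Real.norm_eq_abs]
  exact norm_integral_le_of_norm_le hE.1
    ((ae_restrict_iff' measurableSet_Ioc).2 (ae_of_all _ hdiff))

theorem hasIntegralOn_rpow_mul_const_mul_rpow {α q t : ℝ} (k : ℝ) (hq : 0 < q + 1 - 2 * α)
    (ht : 0 < t) :
    HasIntegralOn (fun r => r ^ (-(2 * α)) * (k * r ^ q)) (Ioc 0 t)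
      (k / (q + 1 - 2 * α) * t ^ (q + 1 - 2 * α)) := by
  refine (((hasIntegralOn_rpow_Ioc (p := -(2 * α) + q) (by linarith) ht).const_mul k).congr
    measurableSet_Ioc fun r hr => ?_).congr_val ?_
  · rw [Real.rpow_add hr.1]
    ring
  · rw [show -(2 * α) + q + 1 = q + 1 - 2 * α by ring]
    ring

theorem hasIntegralOn_rpow_mul_const {α t : ℝ} (k : ℝ) (hα : α < 1 / 2) (ht : 0 < t) :
    HasIntegralOn (fun r => r ^ (-(2 * α)) * k) (Ioc 0 t)
      (k / (1 - 2 * α) * t ^ (1 - 2 * α)) := by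
  simpa using hasIntegralOn_rpow_mul_const_mul_rpow (q := 0) k (by linarith) ht

/-- The form of `abs_toReal_calH_sub_le` used for an error term that is a power of `t`. -/
theorem calH_isBigO_rpow {d : ℕ} (hd : 1 ≤ d) {s α k q : ℝ} {M T MI : ℝ → ℝ} (hs : 0 < s)
    (hq : 0 < q + 1 - 2 * α)
    (hKM : ∀ r, 0 < r → r ≤ 1 → |kummer ((d : ℝ) / 2) (s / 2) r - M r| ≤ k * r ^ q)
    (hM : ∀ t, 0 < t → t ≤ 1 → HasIntegralOn (fun r => r ^ (-(2 * α)) * M r) (Ioc 0 t) (MI t))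
    (hT : ∀ t, 0 < t → T t = Real.pi ^ ((d : ℝ) / 2) / Real.Gamma ((d : ℝ) / 2) * MI t) :
    (fun t : ℝ => (calH (spectralMeasure (besselKernel d s)) α t).toReal - T t)
      =O[𝓝[>] 0] fun t : ℝ => t ^ (q + 1 - 2 * α) := by
  refine IsBigO.of_bound (Real.pi ^ ((d : ℝ) / 2) / Real.Gamma ((d : ℝ) / 2) *
    (k / (q + 1 - 2 * α))) ?_
  filter_upwards [Ioc_mem_nhdsGT one_pos] with t ht
  have h := abs_toReal_calH_sub_le hd hs ht.2 hKM (hM t ht.1 ht.2)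
    (hasIntegralOn_rpow_mul_const_mul_rpow k hq ht.1)
  rw [hT t ht.1, Real.norm_eq_abs, Real.norm_of_nonneg (Real.rpow_nonneg ht.1.le _), mul_assoc]
  exact h

/-- The form of `abs_toReal_calH_sub_le` used for a logarithmic error term. -/
theorem calH_isBigO_rpow_mul_log {d : ℕ} (hd : 1 ≤ d) {s α k : ℝ} {M T MI : ℝ → ℝ} (hs : 0 < s)
    (hα : α < 1 / 2) (hk : 0 ≤ k)
    (hKM : ∀ r, 0 < r → r ≤ 1 →
      |kummer ((d : ℝ) / 2) (s / 2) r - M r| ≤ k * (r * (2 - Real.log r)))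
    (hM : ∀ t, 0 < t → t ≤ 1 → HasIntegralOn (fun r => r ^ (-(2 * α)) * M r) (Ioc 0 t) (MI t))
    (hT : ∀ t, 0 < t → T t = Real.pi ^ ((d : ℝ) / 2) / Real.Gamma ((d : ℝ) / 2) * MI t) :
    (fun t : ℝ => (calH (spectralMeasure (besselKernel d s)) α t).toReal - T t)
      =O[𝓝[>] 0] fun t : ℝ => t ^ (2 * (1 - α)) * Real.log t := by
  have hd0 : (0 : ℝ) < (d : ℝ) / 2 := by
    have : (1 : ℝ) ≤ d := by exact_mod_cast hd
    linarith
  have hG := Real.Gamma_pos_of_pos hd0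
  have hq : 0 < 2 * (1 - α) := by linarith
  refine IsBigO.of_bound (Real.pi ^ ((d : ℝ) / 2) / Real.Gamma ((d : ℝ) / 2) *
    (k * (3 / (2 * (1 - α)) + 1 / (2 * (1 - α)) ^ 2))) ?_
  -- For t ≤ e^{-1} one has -log t ≥ 1, so pure powers of t are absorbed into the logarithmic term.
  filter_upwards [Ioc_mem_nhdsGT (Real.exp_pos (-1))] with t ht
  have ht1 : t ≤ 1 := ht.2.trans (Real.exp_le_one_iff.2 (by norm_num))
  have hlog : Real.log t ≤ -1 := by
    have := Real.log_le_log ht.1 ht.2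
    rwa [Real.log_exp] at this
  have hE := (((hasIntegralOn_rpow_Ioc (p := 1 - 2 * α) (by linarith) ht.1).const_mul 2).sub
    (hasIntegralOn_rpow_mul_log (p := 1 - 2 * α) (by linarith) ht.1 ht1)).const_mul k
  have h := abs_toReal_calH_sub_le hd hs ht1 hKM (hM t ht.1 ht1)
    (hE.congr (g := fun r => r ^ (-(2 * α)) * (k * (r * (2 - Real.log r)))) measurableSet_Ioc
      fun r hr => by
        rw [show 1 - 2 * α = -(2 * α) + 1 by ring, Real.rpow_add hr.1, Real.rpow_one]
        ring)
  rw [hT t ht.1, Real.norm_eq_abs, norm_mul, Real.norm_of_nonneg (Real.rpow_nonneg ht.1.le _),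
    Real.norm_of_nonpos (by linarith), mul_assoc]
  refine h.trans (mul_le_mul_of_nonneg_left ?_ (by positivity))
  rw [mul_assoc]
  refine mul_le_mul_of_nonneg_left ?_ hk
  rw [show 1 - 2 * α + 1 = 2 * (1 - α) by ring]
  have hX : 0 ≤ t ^ (2 * (1 - α)) := Real.rpow_nonneg ht.1.le _
  have h1 : t ^ (2 * (1 - α)) ≤ t ^ (2 * (1 - α)) * -Real.log t := by nlinarith
  have h2 : 0 ≤ 2 / (2 * (1 - α)) + 1 / (2 * (1 - α)) ^ 2 := by positivity
  have h3 := mul_le_mul_of_nonneg_left h1 h2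
  calc _ = (2 / (2 * (1 - α)) + 1 / (2 * (1 - α)) ^ 2) * t ^ (2 * (1 - α)) +
        1 / (2 * (1 - α)) * (t ^ (2 * (1 - α)) * -Real.log t) := by ring
    _ ≤ (2 / (2 * (1 - α)) + 1 / (2 * (1 - α)) ^ 2) * (t ^ (2 * (1 - α)) * -Real.log t) +
        1 / (2 * (1 - α)) * (t ^ (2 * (1 - α)) * -Real.log t) := by linarith
    _ = _ := by ring

theorem calH_asymptotic_of_lt {d : ℕ} (hd : 1 ≤ d) {s α : ℝ} (hs : 0 < s) (hα : α < 1 / 2)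
    (h1 : (d : ℝ) - 2 < s) (h2 : s < d) (h3 : α < 1 / 2 - (d - s) / 4) :
    (fun t : ℝ => (calH (spectralMeasure (besselKernel d s)) α t).toReal -
        (Real.pi ^ ((d : ℝ) / 2) * Real.Gamma ((d - s) / 2) /
            (((s - d) / 2 + 1 - 2 * α) * Real.Gamma ((d : ℝ) / 2)) *
            t ^ ((s - d) / 2 + 1 - 2 * α) +
          Real.pi ^ ((d : ℝ) / 2) * Real.Gamma ((s - d) / 2) /
            ((1 - 2 * α) * Real.Gamma (s / 2)) * t ^ (1 - 2 * α)))
      =O[𝓝[>] 0] fun t : ℝ => t ^ ((s - d) / 2 + 2 * (1 - α)) := by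
  have hd0 : (0 : ℝ) < (d : ℝ) / 2 := by linarith
  have hG := Real.Gamma_pos_of_pos hd0
  rw [show (s - d) / 2 + 2 * (1 - α) = (1 + s / 2 - (d : ℝ) / 2) + 1 - 2 * α by ring]
  refine calH_isBigO_rpow hd hs (by linarith)
    (fun r hr _ => abs_kummer_sub_le_of_lt (by linarith) (by linarith) (by linarith) hr)
    (fun t ht _ => ((hasIntegralOn_rpow_mul_const_mul_rpow (q := s / 2 - (d : ℝ) / 2) _
      (by linarith) ht).add (hasIntegralOn_rpow_mul_const _ hα ht)).congr measurableSet_Ioc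
      fun r _ => (mul_add _ _ _).symm) fun t ht => ?_
  rw [show s / 2 - (d : ℝ) / 2 = (s - d) / 2 by ring, show (d : ℝ) / 2 - s / 2 = (d - s) / 2 by ring]
  have e1 : (s - d) / 2 + 1 - 2 * α ≠ 0 := by linarith
  have e2 : 1 - 2 * α ≠ 0 := by linarith
  have e3 := Real.Gamma_pos_of_pos (show 0 < s / 2 by linarith)
  field_simp

theorem calH_asymptotic_of_eq {d : ℕ} (hd : 1 ≤ d) {s α : ℝ} (hs : 0 < s) (hα : α < 1 / 2)
    (h : s = d) :
    (fun t : ℝ => (calH (spectralMeasure (besselKernel d s)) α t).toReal -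
        (Real.pi ^ ((d : ℝ) / 2) / ((1 - 2 * α) * Real.Gamma ((d : ℝ) / 2)) *
            t ^ (1 - 2 * α) * Real.log (1 / t) +
          Real.pi ^ ((d : ℝ) / 2) *
              (1 - (1 - 2 * α) *
                (digamma ((d : ℝ) / 2) + 2 * Real.eulerMascheroniConstant)) /
            ((1 - 2 * α) ^ 2 * Real.Gamma ((d : ℝ) / 2)) * t ^ (1 - 2 * α)))
      =O[𝓝[>] 0] fun t : ℝ => t ^ (2 * (1 - α)) * Real.log t := by
  have hd0 : (0 : ℝ) < (d : ℝ) / 2 := by linarith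
  have hG := Real.Gamma_pos_of_pos hd0
  refine calH_isBigO_rpow_mul_log hd hs hα (k := 2 * (|(d : ℝ) / 2 - 1| + 3) + 1) (by positivity)
    (fun r hr hr1 => by
      rw [show s / 2 = (d : ℝ) / 2 by rw [h]]
      exact abs_kummer_sub_le_of_eq hd0 hr hr1)
    (fun t ht ht1 => ((hasIntegralOn_rpow_mul_const
      (-digamma ((d : ℝ) / 2) - 2 * Real.eulerMascheroniConstant) hα ht).sub
      (hasIntegralOn_rpow_mul_log (p := -(2 * α)) (by linarith) ht ht1)).congr measurableSet_Ioc
      fun r _ => by ring) fun t ht => ?_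
  have e2 : 1 - 2 * α ≠ 0 := by linarith
  rw [one_div, Real.log_inv, show -(2 * α) + 1 = 1 - 2 * α by ring]
  field_simp
  ring

theorem calH_asymptotic_of_gt {d : ℕ} (hd : 1 ≤ d) {s α : ℝ} (hs : 0 < s) (hα : α < 1 / 2)
    (h1 : (d : ℝ) < s) (h2 : s < d + 2) :
    (fun t : ℝ => (calH (spectralMeasure (besselKernel d s)) α t).toReal -
        Real.pi ^ ((d : ℝ) / 2) * Real.Gamma ((s - d) / 2) /
          ((1 - 2 * α) * Real.Gamma (s / 2)) * t ^ (1 - 2 * α))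
      =O[𝓝[>] 0] fun t : ℝ => t ^ ((s - d) / 2 + 1 - 2 * α) := by
  have hd0 : (0 : ℝ) < (d : ℝ) / 2 := by
    have : (1 : ℝ) ≤ d := by exact_mod_cast hd
    linarith
  have hG := Real.Gamma_pos_of_pos hd0
  rw [show (s - d) / 2 + 1 - 2 * α = (s / 2 - (d : ℝ) / 2) + 1 - 2 * α by ring]
  refine calH_isBigO_rpow hd hs (by linarith)
    (fun r hr _ => abs_kummer_sub_le_of_lt_add_one hd0 (by linarith) (by linarith) hr)
    (fun t ht _ => hasIntegralOn_rpow_mul_const _ hα ht) fun t ht => ?_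
  rw [show s / 2 - (d : ℝ) / 2 = (s - d) / 2 by ring]
  have e2 : 1 - 2 * α ≠ 0 := by linarith
  have e3 := Real.Gamma_pos_of_pos (show 0 < s / 2 by linarith)
  field_simp

theorem calH_asymptotic_of_eq_add_two {d : ℕ} (hd : 1 ≤ d) {s α : ℝ} (hs : 0 < s)
    (hα : α < 1 / 2) (h : s = d + 2) :
    (fun t : ℝ => (calH (spectralMeasure (besselKernel d s)) α t).toReal -
        Real.pi ^ ((d : ℝ) / 2) /
          ((1 - 2 * α) * Real.Gamma ((d : ℝ) / 2 + 1)) * t ^ (1 - 2 * α))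
      =O[𝓝[>] 0] fun t : ℝ => t ^ (2 * (1 - α)) * Real.log t := by
  have hd0 : (0 : ℝ) < (d : ℝ) / 2 := by
    have : (1 : ℝ) ≤ d := by exact_mod_cast hd
    linarith
  have hG := Real.Gamma_pos_of_pos hd0
  refine calH_isBigO_rpow_mul_log hd hs hα zero_le_one
    (fun r hr hr1 => by
      rw [show s / 2 = (d : ℝ) / 2 + 1 by rw [h]; ring, one_mul]
      exact abs_kummer_sub_le_of_eq_add_one hd0 hr hr1)
    (fun t ht _ => hasIntegralOn_rpow_mul_const _ hα ht) fun t ht => ?_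
  -- At c = a + 1 the factor Γ(c - a) is Γ(1) = 1.
  rw [add_sub_cancel_left, Real.Gamma_one]
  have e2 : 1 - 2 * α ≠ 0 := by linarith
  have e3 := Real.Gamma_pos_of_pos (show 0 < (d : ℝ) / 2 + 1 by linarith)
  field_simp

theorem calH_asymptotic_of_add_two_lt {d : ℕ} (hd : 1 ≤ d) {s α : ℝ} (hs : 0 < s)
    (hα : α < 1 / 2) (h : (d : ℝ) + 2 < s) :
    (fun t : ℝ => (calH (spectralMeasure (besselKernel d s)) α t).toReal -
        Real.pi ^ ((d : ℝ) / 2) * Real.Gamma ((s - d) / 2) /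
          ((1 - 2 * α) * Real.Gamma (s / 2)) * t ^ (1 - 2 * α))
      =O[𝓝[>] 0] fun t : ℝ => t ^ (2 * (1 - α)) := by
  have hd0 : (0 : ℝ) < (d : ℝ) / 2 := by
    have : (1 : ℝ) ≤ d := by exact_mod_cast hd
    linarith
  have hG := Real.Gamma_pos_of_pos hd0
  rw [show 2 * (1 - α) = 1 + 1 - 2 * α by ring]
  refine calH_isBigO_rpow hd hs (by linarith)
    (fun r hr _ => by
      rw [Real.rpow_one]
      exact abs_kummer_sub_le_of_add_one_lt hd0 (by linarith) hr)
    (fun t ht _ => hasIntegralOn_rpow_mul_const _ hα ht) fun t ht => ?_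
  rw [show s / 2 - (d : ℝ) / 2 = (s - d) / 2 by ring]
  have e2 : 1 - 2 * α ≠ 0 := by linarith
  have e3 := Real.Gamma_pos_of_pos (show 0 < s / 2 by linarith)
  field_simp

end BesselNoise

end

open BesselNoise in
theorem proposition5p11 (d : ℕ) (hd : 1 ≤ d) (s : ℝ) (hs : 0 < s) :
    -- value of `Υ_α(0)`
    (∀ α : ℝ, 0 < (d : ℝ) - 2 * (1 - α) → (d : ℝ) - 2 * (1 - α) < s →
      upsilon (spectralMeasure (besselKernel d s)) α 0 =
        ENNReal.ofReal
          (Real.Gamma ((d : ℝ) / 2 - 1 + α) * Real.Gamma ((s - d) / 2 + 1 - α) /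
            (2 ^ d * Real.pi ^ ((d : ℝ) / 2) * Real.Gamma ((d : ℝ) / 2) * Real.Gamma (s / 2)))) ∧
    -- the case `α = 0`
    (0 < (d : ℝ) - 2 → (d : ℝ) - 2 < s →
      upsilon (spectralMeasure (besselKernel d s)) 0 0 =
        ENNReal.ofReal
          (Real.Gamma ((2 + s - d) / 2) /
            (2 ^ ((d : ℝ) - 1) * Real.pi ^ ((d : ℝ) / 2) * ((d : ℝ) - 2) *
              Real.Gamma (s / 2)))) ∧
    -- finiteness of `𝓗_α`
    (∀ α : ℝ, 0 < α →
      ((∀ t : ℝ, 0 < t → calH (spectralMeasure (besselKernel d s)) α t < ⊤) ↔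
        α < 1 / 2 - max ((d : ℝ) - s) 0 / 4 ∧ (d : ℝ) - 2 < s)) ∧
    -- asymptotics of `𝓗_α(t)` as `t → 0+`
    (∀ α : ℝ, 0 < α → α < 1 / 2 →
      ((d : ℝ) - 2 < s → s < d → α < 1 / 2 - (d - s) / 4 →
        (fun t : ℝ => (calH (spectralMeasure (besselKernel d s)) α t).toReal -
            (Real.pi ^ ((d : ℝ) / 2) * Real.Gamma ((d - s) / 2) /
                (((s - d) / 2 + 1 - 2 * α) * Real.Gamma ((d : ℝ) / 2)) *
                t ^ ((s - d) / 2 + 1 - 2 * α) +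
              Real.pi ^ ((d : ℝ) / 2) * Real.Gamma ((s - d) / 2) /
                ((1 - 2 * α) * Real.Gamma (s / 2)) * t ^ (1 - 2 * α)))
          =O[𝓝[>] 0] fun t : ℝ => t ^ ((s - d) / 2 + 2 * (1 - α))) ∧
      (s = d →
        (fun t : ℝ => (calH (spectralMeasure (besselKernel d s)) α t).toReal -
            (Real.pi ^ ((d : ℝ) / 2) / ((1 - 2 * α) * Real.Gamma ((d : ℝ) / 2)) *
                t ^ (1 - 2 * α) * Real.log (1 / t) +
              Real.pi ^ ((d : ℝ) / 2) *
                  (1 - (1 - 2 * α) *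
                    (digamma ((d : ℝ) / 2) + 2 * Real.eulerMascheroniConstant)) /
                ((1 - 2 * α) ^ 2 * Real.Gamma ((d : ℝ) / 2)) * t ^ (1 - 2 * α)))
          =O[𝓝[>] 0] fun t : ℝ => t ^ (2 * (1 - α)) * Real.log t) ∧
      ((d : ℝ) < s → s < d + 2 →
        (fun t : ℝ => (calH (spectralMeasure (besselKernel d s)) α t).toReal -
            Real.pi ^ ((d : ℝ) / 2) * Real.Gamma ((s - d) / 2) /
              ((1 - 2 * α) * Real.Gamma (s / 2)) * t ^ (1 - 2 * α))
          =O[𝓝[>] 0] fun t : ℝ => t ^ ((s - d) / 2 + 1 - 2 * α)) ∧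
      (s = d + 2 →
        (fun t : ℝ => (calH (spectralMeasure (besselKernel d s)) α t).toReal -
            Real.pi ^ ((d : ℝ) / 2) /
              ((1 - 2 * α) * Real.Gamma ((d : ℝ) / 2 + 1)) * t ^ (1 - 2 * α))
          =O[𝓝[>] 0] fun t : ℝ => t ^ (2 * (1 - α)) * Real.log t) ∧
      ((d : ℝ) + 2 < s →
        (fun t : ℝ => (calH (spectralMeasure (besselKernel d s)) α t).toReal -
            Real.pi ^ ((d : ℝ) / 2) * Real.Gamma ((s - d) / 2) /
              ((1 - 2 * α) * Real.Gamma (s / 2)) * t ^ (1 - 2 * α))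
          =O[𝓝[>] 0] fun t : ℝ => t ^ (2 * (1 - α)))) := by
  refine ⟨fun α h1 h2 => upsilon_besselKernel hd hs h1 h2,
    fun h1 h2 => upsilon_zero_besselKernel hd hs h1 h2,
    fun α hα => calH_lt_top_iff hd hs hα, fun α _ hα => ⟨?_, ?_, ?_, ?_, ?_⟩⟩
  · exact calH_asymptotic_of_lt hd hs hα
  · exact calH_asymptotic_of_eq hd hs hα
  · exact calH_asymptotic_of_gt hd hs hα
  · exact calH_asymptotic_of_eq_add_two hd hs hα
  · exact calH_asymptotic_of_add_two_lt hd hs hα
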